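/- Let $\mu>0$ and $\nu,\beta\in(0,1]$. The Fox function with real parameters is the Mellin–Barnes integral $$H^{m,n}_{p,q}\left[x\,\Big|\,\begin{array}{c}(a_i,\alpha_i)_{i\le p}\\(b_j,\beta_j)_{j\le q}\end{array}\right]=\frac1{2\pi i}\int_{\Re\eta=c}\frac{\prod_{j=1}^m\Gamma(b_j+\eta\beta_j)\prod_{i=1}^n\Gamma(1-a_i-\eta\alpha_i)}{\prod_{j=m+1}^q\Gamma(1-b_j-\eta\beta_j)\prod_{i=n+1}^p\Gamma(a_i+\eta\alpha_i)}\,x^{-\eta}\,d\eta ,$$ where the line $\Re\eta=c$ is such that $b_j+c\beta_j>0$ for $j\le m$ and $1-a_i-c\alpha_i>0$ for $i\le n$. For $x,t>0$ let $$g^1_\mu(x,t)=\frac1t\,\frac{(x/t)^{\mu-1}}{\Gamma(\mu)}\,e^{-x/t}$$ and, for an index $\alpha\in(0,1)$, $$h_\alpha(x,t)=\frac1{\alpha t^{1/\alpha}}H^{0,1}_{1,1}\left[\frac{x}{t^{1/\alpha}}\,\Big|\,\begin{array}{c}(1-\frac1\alpha,\frac1\alpha)\\(0,1)\end{array}\right],\qquad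 l_\alpha(x,t)=\frac1{t^{\alpha}}H^{1,0}_{1,1}\left[\frac{x}{t^{\alpha}}\,\Big|\,\begin{array}{c}(1-\alpha,\alpha)\\(0,1)\end{array}\right]$$ (the densities of the $\alpha$-stable subordinator at time $t$ and of its inverse), while $h_1(x,t)\,dx$ and $l_1(x,t)\,dx$ denote the unit mass at $x=t$. Put $$\mathfrak f_{\nu,\beta}(x,t)=\int_0^\infty h_\nu(x,s)\,l_\beta(s,t)\,ds$$ (so $\mathfrak f_{\nu,1}=h_\nu$, $\mathfrak f_{1,\beta}=l_\beta$, and $\mathfrak f_{1,1}(x,t)\,dx$ is the unit mass at $x=t$), $$\mathfrak g^\nu_\mu(x,t)=\int_0^\infty g^1_\mu(x,s)\,h_\nu(s,t)\,ds,\qquad \mathbf g^{\nu,\beta}_\mu(x,t)=\int_0^\infty g^1_\mu(x,s)\,\mathfrak f_{\nu,\beta}(s,t)\,ds .$$ For $0<\alpha<1$ and $x>0$ let $$\frac{\partial^\alpha\varphi}{\partial x^\alpha}(x)=\frac1{\Gamma(1-\alpha)}\frac{d}{dx}\int_0^x(x-s)^{-\alpha}\varphi(s)\,ds,\qquad \frac{\partial^\alpha\varphi}{\partial(-x)^\alpha}(x)=-\frac1{\Gamma(1-\alpha)}\frac{d}{dx}\int_x^\infty(s-x)^{-\alpha}\varphi(s)\,ds$$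 be the left and right Riemann–Liouville derivatives, and $\frac{\partial^1\varphi}{\partial x^1}=\varphi'$, $\frac{\partial^1\varphi}{\partial(-x)^1}=-\varphi'$. In the right derivative only the increments of the integral are used, computed as $\int_0^\infty\big((s-y)_+^{-\alpha}-(s-x)_+^{-\alpha}\big)\varphi(s)\,ds$ for the increment from $x$ to $y$ (which changes nothing if the integral converges, and gives the derivative a meaning if it diverges at infinity while its increments converge). Let $$\mathcal A f=-\frac{\partial^\nu}{\partial x^\nu}\left(x^{\mu-1+\nu}\,\frac{\partial^\nu}{\partial(-x)^\nu}\big(x^{1-\mu}f\big)\right)\quad\text{on }(0,\infty).$$ Then the integrals defining $\mathfrak f_{\nu,\beta}$, $\mathfrak g^\nu_\mu$ and $\mathbf g^{\nu,\beta}_\mu$ converge absolutely, all derivatives below exist, and for all $x,t>0$: (i) $\displaystyle\frac{\partial}{\partial t}\mathfrak g^\nu_\mu(x,t)=\mathcal A\,\mathfrak g^\nu_\mu(x,t)$; (ii) $\displaystyle\frac{\partial^\beta}{\partial t^\beta}\mathbf g^{\nu,\beta}_\mu(x,t)=\mathcal A\,\mathbf g^{\nu,\beta}_\mu(x,t)$.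 If $\nu<1$ and $\mu+2\nu>1$, the integrals $\int_x^\infty(s-x)^{-\nu}s^{1-\mu}u(s,t)\,ds$ for $u=\mathfrak g^\nu_\mu$ and $u=\mathbf g^{\nu,\beta}_\mu$ converge absolutely, so that the right derivatives in (i) and (ii) are the classical ones. Furthermore $$\mathbf g^{\nu,\beta}_\mu(x,t)=\frac1{t^{\beta/\nu}}\,\mathbf G^{\nu,\beta}_\mu\!\left(\frac{x}{t^{\beta/\nu}}\right),\qquad \mathbf G^{\nu,\beta}_\mu(x)=\frac1{\nu x}\,H^{2,1}_{3,3}\left[x\,\Big|\,\begin{array}{ccc}(1,\frac1\nu);&(1,\frac\beta\nu);&(\mu,0)\\(\mu,1);&(1,\frac1\nu);&(1,1)\end{array}\right],$$ where lines $\Re\eta=c$ as above exist (they are those with $-\min\{\mu,\nu\}<c<0$), and on each of them the Mellin–Barnes integral converges absolutely and gives this value. -/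

import Mathlib

open MeasureTheory Filter Topology Set

/-- The Mellin transform
`∏_{j ≤ m} Γ(b_j + η β_j) ∏_{i ≤ n} Γ(1 - a_i - η α_i) /
  (∏_{j > m} Γ(1 - b_j - η β_j) ∏_{i > n} Γ(a_i + η α_i))`
of the Fox function `H^{m,n}_{p,q}` with upper parameters `A i = (a_i, α_i)` and lower parameters
`B j = (b_j, β_j)`. Mathlib's value `Γ = 0` at the poles together with `1 / 0 = 0` gives the usual
convention for `1 / Γ`. -/
noncomputable def foxKernel (m n : ℕ) {p q : ℕ} (A : Fin p → ℝ × ℝ) (B : Fin q → ℝ × ℝ)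
    (η : ℂ) : ℂ :=
  ((∏ j : Fin q with j.val < m, Complex.Gamma ((B j).1 + η * (B j).2)) *
      ∏ i : Fin p with i.val < n, Complex.Gamma (1 - (A i).1 - η * (A i).2)) /
    ((∏ j : Fin q with m ≤ j.val, Complex.Gamma (1 - (B j).1 - η * (B j).2)) *
      ∏ i : Fin p with n ≤ i.val, Complex.Gamma ((A i).1 + η * (A i).2))

/-- The vertical line `Re η = c` separates the poles of the Gamma functions `Γ(b_j + η β_j)`,
`j ≤ m`, (on its left) from those of `Γ(1 - a_i - η α_i)`, `i ≤ n`, (on its right): all these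
Gamma functions are evaluated in the right half plane. -/
def FoxContour (c : ℝ) (m n : ℕ) {p q : ℕ} (A : Fin p → ℝ × ℝ) (B : Fin q → ℝ × ℝ) : Prop :=
  (∀ j : Fin q, j.val < m → 0 < (B j).1 + c * (B j).2) ∧
    ∀ i : Fin p, i.val < n → 0 < 1 - (A i).1 - c * (A i).2

/-- The Fox function `H^{m,n}_{p,q}` as the Mellin-Barnes integral
`(1 / 2πi) ∫ foxKernel(η) x^{-η} dη` along the vertical line `Re η = c`; the line is meant to
satisfy `FoxContour`. -/
noncomputable def foxH (c : ℝ) (m n : ℕ) {p q : ℕ} (A : Fin p → ℝ × ℝ) (B : Fin q → ℝ × ℝ)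
    (x : ℝ) : ℂ :=
  mellinInv c (foxKernel m n A B) x

/-- The density `h_ν(x, t)` of the stable subordinator of index `ν ∈ (0, 1)` at time `t`, the law
with Laplace transform `exp (-t λ^ν)`:
`h_ν(x, t) = (1 / (ν t^{1/ν})) H^{0,1}_{1,1}[x / t^{1/ν} | (1 - 1/ν, 1/ν); (0, 1)]`.
Every line `Re η = c` with `c < 1` separates the poles. -/
noncomputable def stableDensity (ν x t : ℝ) : ℝ :=
  1 / (ν * t ^ (1 / ν)) *
    (foxH (1 / 2) 0 1 ![(1 - 1 / ν, 1 / ν)] ![(0, 1)] (x / t ^ (1 / ν))).re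

/-- The density `l_ν(x, t)` of the inverse of the stable subordinator of index `ν ∈ (0, 1)`:
`l_ν(x, t) = t^{-ν} H^{1,0}_{1,1}[x / t^ν | (1 - ν, ν); (0, 1)]`.
Every line `Re η = c` with `c > 0` separates the poles. -/
noncomputable def inverseStableDensity (ν x t : ℝ) : ℝ :=
  1 / t ^ ν * (foxH (1 / 2) 1 0 ![(1 - ν, ν)] ![(0, 1)] (x / t ^ ν)).re

/-- The one-dimensional density `g¹_μ(x, t) = (1/t) Q(x/t)`, `Q(z) = z^{μ-1} e^{-z} / Γ(μ)`, of the
squared Bessel process started at zero. -/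
noncomputable def besselDensity (μ x t : ℝ) : ℝ :=
  1 / t * ((x / t) ^ (μ - 1) / Real.Gamma μ * Real.exp (-(x / t)))

/-- The density `𝔣_{ν,β}(x, t) = ∫ h_ν(x, s) l_β(s, t) ds` of the stable subordinator of index `ν`
at the inverse of an independent one of index `β`. As `h_1(x, s) ds` and `l_1(x, s)` stand for the
unit mass at `x = s`, it is `h_ν` for `β = 1` and `l_β` for `ν = 1`; it is not used when both
indices are `1`. -/
noncomputable def mixedDensity (ν β x t : ℝ) : ℝ :=
  if β = 1 then stableDensity ν x t
  else if ν = 1 then inverseStableDensity β x t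
  else ∫ s in Ioi (0 : ℝ), stableDensity ν x s * inverseStableDensity β s t

/-- `𝔤^ν_μ(x, t) = ∫ g¹_μ(x, s) h_ν(s, t) ds`, where `h_1(s, t) ds` is the unit mass at `t`. -/
noncomputable def subordinatedDensity (μ ν x t : ℝ) : ℝ :=
  if ν = 1 then besselDensity μ x t
  else ∫ s in Ioi (0 : ℝ), besselDensity μ x s * stableDensity ν s t

/-- `𝐠^{ν,β}_μ(x, t) = ∫ g¹_μ(x, s) 𝔣_{ν,β}(s, t) ds`, where `𝔣_{1,1}(s, t) ds` is the unit mass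
at `t`. -/
noncomputable def doublySubordinatedDensity (μ ν β x t : ℝ) : ℝ :=
  if ν = 1 ∧ β = 1 then besselDensity μ x t
  else ∫ s in Ioi (0 : ℝ), besselDensity μ x s * mixedDensity ν β s t

/-- The left Riemann-Liouville derivative of order `α ∈ (0, 1]` on `(0, ∞)`,
`(1 / Γ(1-α)) d/dx ∫_0^x (x-s)^{-α} φ(s) ds`, the ordinary derivative for `α = 1`, exists at `x` and
has the value `v`. -/
def HasLeftFracDerivAt (α : ℝ) (φ : ℝ → ℝ) (v x : ℝ) : Prop :=
  if α = 1 then HasDerivAt φ v x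
  else
    (∀ᶠ y in 𝓝 x, IntegrableOn (fun s => (y - s) ^ (-α) * φ s) (Ioo 0 y)) ∧
      HasDerivAt
        (fun y => 1 / Real.Gamma (1 - α) * ∫ s in Ioo 0 y, (y - s) ^ (-α) * φ s) v x

/-- The kernel `(s - x)_+^{-α}`. -/
noncomputable def weylKernel (α x s : ℝ) : ℝ :=
  if x < s then (s - x) ^ (-α) else 0

/-- The right Riemann-Liouville (Weyl) derivative of order `α ∈ (0, 1]` on `(0, ∞)`,
`-(1 / Γ(1-α)) d/dx ∫_x^∞ (s-x)^{-α} φ(s) ds`, which is `-φ'` for `α = 1`, exists at `x` and has the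
value `v`. Only the increments of the integral matter for its derivative, and they are computed
here as the integral over `s` of `((s-y)_+^{-α} - (s-x)_+^{-α}) φ(s)`. This changes nothing when
the integral itself converges (`hasRightFracDerivAt_iff`), and gives the derivative its usual
meaning for those slowly decaying `φ` for which the integral diverges at infinity while its
increments converge. -/
def HasRightFracDerivAt (α : ℝ) (φ : ℝ → ℝ) (v x : ℝ) : Prop :=
  if α = 1 then HasDerivAt φ (-v) x
  else
    (∀ᶠ y in 𝓝 x,
        IntegrableOn (fun s => (weylKernel α y s - weylKernel α x s) * φ s) (Ioi 0)) ∧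
      HasDerivAt
        (fun y => -(1 / Real.Gamma (1 - α)) *
          ∫ s in Ioi (0 : ℝ), (weylKernel α y s - weylKernel α x s) * φ s) v x

theorem weylKernel_integrableOn_iff {α : ℝ} {φ : ℝ → ℝ} {y : ℝ} (hy : 0 < y) :
    IntegrableOn (fun s => weylKernel α y s * φ s) (Ioi 0) ↔
      IntegrableOn (fun s => (s - y) ^ (-α) * φ s) (Ioi y) := by
  have h : (fun s => weylKernel α y s * φ s) =
      (Ioi y).indicator (fun s => (s - y) ^ (-α) * φ s) := by
    funext s
    by_cases hs : y < s <;> simp [weylKernel, Set.indicator, hs]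
  rw [h, IntegrableOn, integrable_indicator_iff measurableSet_Ioi, IntegrableOn, IntegrableOn,
    Measure.restrict_restrict measurableSet_Ioi,
    inter_eq_left.mpr (Ioi_subset_Ioi hy.le)]

theorem weylKernel_integral {α : ℝ} {φ : ℝ → ℝ} {y : ℝ} (hy : 0 < y) :
    ∫ s in Ioi (0 : ℝ), weylKernel α y s * φ s = ∫ s in Ioi y, (s - y) ^ (-α) * φ s := by
  have h : (fun s => weylKernel α y s * φ s) =
      (Ioi y).indicator (fun s => (s - y) ^ (-α) * φ s) := by
    funext s
    by_cases hs : y < s <;> simp [weylKernel, Set.indicator, hs]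
  rw [h, integral_indicator measurableSet_Ioi, Measure.restrict_restrict measurableSet_Ioi,
    inter_eq_left.mpr (Ioi_subset_Ioi hy.le)]

/-- Where the integral `∫_y^∞ (s-y)^{-α} φ(s) ds` converges, `HasRightFracDerivAt` is the
classical definition. -/
theorem hasRightFracDerivAt_iff {α : ℝ} (hα : α ≠ 1) {φ : ℝ → ℝ} {v x : ℝ} (hx : 0 < x)
    (hφ : ∀ᶠ y in 𝓝 x, IntegrableOn (fun s => (s - y) ^ (-α) * φ s) (Ioi y)) :
    HasRightFracDerivAt α φ v x ↔
      HasDerivAt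
        (fun y => -(1 / Real.Gamma (1 - α)) * ∫ s in Ioi y, (s - y) ^ (-α) * φ s) v x := by
  have hpos : ∀ᶠ y in 𝓝 x, 0 < y := lt_mem_nhds hx
  have hx0 := (weylKernel_integrableOn_iff hx).mpr hφ.self_of_nhds
  have hint : ∀ᶠ y in 𝓝 x,
      IntegrableOn (fun s => (weylKernel α y s - weylKernel α x s) * φ s) (Ioi 0) := by
    filter_upwards [hφ, hpos] with y h1 h2
    simp only [sub_mul]
    exact ((weylKernel_integrableOn_iff h2).mpr h1).sub hx0
  have heq : (fun y => -(1 / Real.Gamma (1 - α)) *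
        ∫ s in Ioi (0 : ℝ), (weylKernel α y s - weylKernel α x s) * φ s) =ᶠ[𝓝 x]
      fun y => -(1 / Real.Gamma (1 - α)) * (∫ s in Ioi y, (s - y) ^ (-α) * φ s) -
        -(1 / Real.Gamma (1 - α)) * (∫ s in Ioi x, (s - x) ^ (-α) * φ s) := by
    filter_upwards [hφ, hpos] with y h1 h2
    simp only [sub_mul]
    rw [integral_sub ((weylKernel_integrableOn_iff h2).mpr h1) hx0, weylKernel_integral h2,
      weylKernel_integral hx, mul_sub]
  rw [HasRightFracDerivAt, if_neg hα, and_iff_right hint, heq.hasDerivAt_iff]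
  exact hasDerivAt_sub_const_iff _

/-- The operator
`𝒜 f = -(d/dx)^ν ( x^{μ-1+ν} (d/d(-x))^ν ( x^{1-μ} f ) )` on `(0, ∞)` is defined for `f` at `x` and
has the value `a`; `w` is the inner derivative. -/
def HasCompositeOpAt (μ ν : ℝ) (f : ℝ → ℝ) (a x : ℝ) : Prop :=
  ∃ w : ℝ → ℝ,
    (∀ y, 0 < y → HasRightFracDerivAt ν (fun s => s ^ (1 - μ) * f s) (w y) y) ∧
      HasLeftFracDerivAt ν (fun s => s ^ (μ - 1 + ν) * w s) (-a) x

/-- The upper parameters `(1, 1/ν), (1, β/ν), (μ, 0)` of the function `𝐆`. -/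
noncomputable def upperParams (μ ν β : ℝ) : Fin 3 → ℝ × ℝ :=
  ![(1, 1 / ν), (1, β / ν), (μ, 0)]

/-- The lower parameters `(μ, 1), (1, 1/ν), (1, 1)` of the function `𝐆`. -/
noncomputable def lowerParams (μ ν : ℝ) : Fin 3 → ℝ × ℝ :=
  ![(μ, 1), (1, 1 / ν), (1, 1)]

/-- `𝐆^{ν,β}_μ(x) = (1 / (ν x)) H^{2,1}_{3,3}[x | (1, 1/ν), (1, β/ν), (μ, 0); (μ, 1), (1, 1/ν), (1, 1)]`,
the Mellin-Barnes integral being taken along `Re η = c`. -/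
noncomputable def profileG (c μ ν β x : ℝ) : ℂ :=
  1 / ((ν : ℂ) * x) * foxH c 2 1 (upperParams μ ν β) (lowerParams μ ν) x

/-!
Everything is computed on the Mellin side. In the variable `x t^{-b}`, `b = β/ν`, the densities are
Mellin-Barnes integrals along vertical lines `Re z = c`:

* `h_ν(x, t) = x⁻¹ M[Γ(1 - z/ν) / Γ(1 - z)](x t^{-1/ν})` for `c < ν`,
* `l_β(x, t) = x⁻¹ M[Γ(1 + z) / Γ(1 + β z)](x t^{-β})` for `c > -1`,
* `𝔣_{ν,β}` has the product kernel `k₀(z) = Γ(1 - z/ν) Γ(1 + z/ν) / (Γ(1 - z) Γ(1 + b z))`, and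
  `𝐠^{ν,β}_μ` the kernel `k₀(z) Γ(μ + z) / Γ(μ)`, for `-min{μ, ν} < c < ν`
  (`doublySubordinatedDensity_eq`).

Here `M[K](x) = (1/2πi) ∫ K(z) x^{-z} dz` is Mathlib's `mellinInv`. These kernels decay
exponentially, except `k₀` for `ν = β = 1` (when `𝐠` is the density `g¹_μ` itself), because
`|Γ(σ + iy)|` is `exp (-π|y|/2)` up to powers of `|y|`. That estimate follows from the exact value of
`|Γ(1/2 + iy)|` and from the monotonicity of `|Γ(z)| / Γ(Re z)` along horizontal lines, a consequence
of the Beta integral (`norm_Gamma_le_mul_norm_Gamma_add`). The decay permits moving the line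
(`StripGrowth.mellinInv_eq_mellinInv`), inverting the transform (`StripGrowth.mellin_mellinInv`) and
interchanging integrals (`mellinInv_convolution`).

For the equations, the left derivative of order `α` multiplies `x^P` by `Γ(1 + P) / Γ(1 + P - α)` and
lowers the exponent by `α`, provided that `Re P > -1` (`hasLeftFracDerivAt_of_mellinInv`). The inner
right derivative of `𝒜` acts on `x^{1-μ} 𝐠 = ∫ e^{-x/s} s^{-μ} 𝔣(s, t) ds / Γ(μ)`, where it multiplies
`e^{-x/s}` by `s^{-ν}` (`hasRightFracDerivAt_of_laplace`); this replaces `Γ(μ + z)` by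
`Γ(μ + ν + z)`. The outer left derivative needs a line with `c < 0`. The time derivative is computed
on the line `Re z = c + ν`, which is still in the strip; after the substitution `z ↦ z + ν` the two
integrands coincide by `Γ(z + 1) = z Γ(z)` (`densityKernel_multiplier`). Equation (i) is the case
`β = 1` of (ii).
-/

/-! ### Exponential bounds for the Gamma function in vertical strips -/

/-- Along horizontal lines in the right half plane `|Γ(z)| / Γ(Re z)` is non-decreasing: the quotient
`Γ(z) / Γ(z + a)` is a Beta integral, and so is dominated by its value at `Re z`. -/
theorem norm_Gamma_le_mul_norm_Gamma_add {z : ℂ} {a : ℝ} (hz : 0 < z.re) (ha : 0 < a) :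
    ‖Complex.Gamma z‖ ≤
      Real.Gamma z.re / Real.Gamma (z.re + a) * ‖Complex.Gamma (z + a)‖ := by
  have h1 := Complex.betaIntegral_eq_Gamma_mul_div z a hz (by simpa using ha)
  have h2 := Complex.betaIntegral_eq_Gamma_mul_div z.re a (by simpa using hz) (by simpa using ha)
  have hle : ‖Complex.betaIntegral z a‖ ≤ (Complex.betaIntegral z.re a).re := by
    have hnorm : ∀ x ∈ Ioo (0 : ℝ) 1, ‖(x : ℂ) ^ (z - 1) * (1 - (x : ℂ)) ^ ((a : ℂ) - 1)‖ =
        x ^ (z.re - 1) * (1 - x) ^ (a - 1) := by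
      intro x hx
      have h1x : (1 : ℂ) - x = ((1 - x : ℝ) : ℂ) := by push_cast; ring
      rw [norm_mul, Complex.norm_cpow_eq_rpow_re_of_pos hx.1, h1x,
        Complex.norm_cpow_eq_rpow_re_of_pos (sub_pos.mpr hx.2)]
      simp
    have hval : (Complex.betaIntegral z.re a).re =
        ∫ x in (0 : ℝ)..1, x ^ (z.re - 1) * (1 - x) ^ (a - 1) := by
      have : Complex.betaIntegral z.re a =
          ((∫ x in (0 : ℝ)..1, x ^ (z.re - 1) * (1 - x) ^ (a - 1) : ℝ) : ℂ) := by
        rw [Complex.betaIntegral, ← intervalIntegral.integral_ofReal]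
        refine intervalIntegral.integral_congr fun x hx => ?_
        rw [uIcc_of_le zero_le_one] at hx
        rw [Complex.ofReal_mul, Complex.ofReal_cpow hx.1,
          Complex.ofReal_cpow (sub_nonneg.mpr hx.2)]
        push_cast
        rfl
      rw [this, Complex.ofReal_re]
    rw [hval, Complex.betaIntegral]
    refine (intervalIntegral.norm_integral_le_integral_norm zero_le_one).trans_eq ?_
    rw [intervalIntegral.integral_of_le zero_le_one, intervalIntegral.integral_of_le zero_le_one,
      integral_Ioc_eq_integral_Ioo, integral_Ioc_eq_integral_Ioo]
    exact setIntegral_congr_fun measurableSet_Ioo hnorm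
  have hga : 0 < Real.Gamma a := Real.Gamma_pos_of_pos ha
  have hre : (Complex.betaIntegral z.re a).re =
      Real.Gamma z.re * Real.Gamma a / Real.Gamma (z.re + a) := by
    rw [h2, ← Complex.ofReal_add, Complex.Gamma_ofReal, Complex.Gamma_ofReal, Complex.Gamma_ofReal,
      ← Complex.ofReal_mul, ← Complex.ofReal_div, Complex.ofReal_re]
  have hne : 0 < ‖Complex.Gamma (z + a)‖ :=
    norm_pos_iff.mpr (Complex.Gamma_ne_zero_of_re_pos (by simpa using add_pos hz ha))
  rw [hre, h1, norm_div, norm_mul, Complex.Gamma_ofReal, Complex.norm_real, Real.norm_eq_abs,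
    abs_of_pos hga, div_le_iff₀ hne] at hle
  have : ‖Complex.Gamma z‖ * Real.Gamma a ≤
      (Real.Gamma z.re / Real.Gamma (z.re + a) * ‖Complex.Gamma (z + a)‖) * Real.Gamma a := by
    calc _ ≤ _ := hle
      _ = _ := by ring
  exact le_of_mul_le_mul_right this hga

theorem norm_Gamma_half_add_mul_I_sq (y : ℝ) :
    ‖Complex.Gamma (1 / 2 + y * Complex.I)‖ ^ 2 = Real.pi / Real.cosh (Real.pi * y) := by
  have h := Complex.Gamma_mul_Gamma_one_sub (1 / 2 + y * Complex.I)
  have h1 : (1 : ℂ) - (1 / 2 + y * Complex.I) = (starRingEnd ℂ) (1 / 2 + y * Complex.I) := by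
    simp only [map_add, map_mul, Complex.conj_ofReal, Complex.conj_I, map_div₀, map_one,
      map_ofNat]
    ring
  have h2 : Complex.sin (Real.pi * (1 / 2 + y * Complex.I)) = (Real.cosh (Real.pi * y) : ℝ) := by
    rw [show (Real.pi : ℂ) * (1 / 2 + y * Complex.I) = ((Real.pi * y : ℝ) : ℂ) * Complex.I +
      Real.pi / 2 by push_cast; ring, Complex.sin_add_pi_div_two, Complex.cos_mul_I,
      Complex.ofReal_cosh]
  rw [h1, Complex.Gamma_conj, Complex.mul_conj, h2, Complex.normSq_eq_norm_sq] at h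
  exact_mod_cast h

theorem norm_Gamma_half_add_mul_I_le (y : ℝ) :
    ‖Complex.Gamma (1 / 2 + y * Complex.I)‖ ≤
      Real.sqrt (2 * Real.pi) * Real.exp (-(Real.pi / 2) * |y|) := by
  refine le_of_sq_le_sq ?_ (by positivity)
  rw [norm_Gamma_half_add_mul_I_sq, mul_pow, Real.sq_sqrt (by positivity), ← Real.exp_nat_mul,
    ← Real.cosh_abs, abs_mul, abs_of_pos Real.pi_pos, Real.cosh_eq, div_le_iff₀ (by positivity)]
  have : Real.exp (↑(2 : ℕ) * (-(Real.pi / 2) * |y|)) * Real.exp (Real.pi * |y|) = 1 := by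
    rw [← Real.exp_add, ← Real.exp_zero]; congr 1; push_cast; ring
  have h3 : 0 ≤ Real.exp (↑(2 : ℕ) * (-(Real.pi / 2) * |y|)) * Real.exp (-(Real.pi * |y|)) := by
    positivity
  nlinarith [Real.pi_pos]

theorem le_norm_Gamma_half_add_mul_I (y : ℝ) :
    Real.sqrt Real.pi * Real.exp (-(Real.pi / 2) * |y|) ≤
      ‖Complex.Gamma (1 / 2 + y * Complex.I)‖ := by
  refine le_of_sq_le_sq ?_ (by positivity)
  rw [norm_Gamma_half_add_mul_I_sq, mul_pow, Real.sq_sqrt (by positivity), ← Real.exp_nat_mul,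
    ← Real.cosh_abs, abs_mul, abs_of_pos Real.pi_pos, Real.cosh_eq, le_div_iff₀ (by positivity)]
  have : Real.exp (↑(2 : ℕ) * (-(Real.pi / 2) * |y|)) * Real.exp (Real.pi * |y|) = 1 := by
    rw [← Real.exp_add, ← Real.exp_zero]; congr 1; push_cast; ring
  have h3 : Real.exp (-(Real.pi * |y|)) ≤ Real.exp (Real.pi * |y|) := by
    apply Real.exp_le_exp.mpr
    have : 0 ≤ Real.pi * |y| := by positivity
    linarith
  have h4 : 0 ≤ Real.exp (↑(2 : ℕ) * (-(Real.pi / 2) * |y|)) := by positivity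
  have h5 := mul_le_mul_of_nonneg_left h3 h4
  nlinarith [Real.pi_pos]

theorem norm_le_add_mul_one_add_abs_im (z : ℂ) : ‖z‖ ≤ (1 + |z.re|) * (1 + |z.im|) := by
  have := Complex.norm_le_abs_re_add_abs_im z
  nlinarith [mul_nonneg (abs_nonneg z.re) (abs_nonneg z.im)]

theorem norm_Gamma_add_nat_le {z : ℂ} (hz : 0 < z.re) (n : ℕ) :
    ‖Complex.Gamma (z + n)‖ ≤ (‖z‖ + n) ^ n * ‖Complex.Gamma z‖ := by
  induction n with
  | zero => simp
  | succ n ih =>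
    have hne : z + n ≠ 0 := by
      intro h
      have := congrArg Complex.re h
      simp at this
      have hn : (0 : ℝ) ≤ n := n.cast_nonneg
      linarith
    have h1 : z + ((n + 1 : ℕ) : ℂ) = (z + n) + 1 := by push_cast; ring
    rw [h1, Complex.Gamma_add_one _ hne, norm_mul, pow_succ', mul_assoc]
    have hb : ‖z + n‖ ≤ ‖z‖ + ((n + 1 : ℕ) : ℝ) := by
      refine (norm_add_le _ _).trans ?_
      rw [Complex.norm_natCast]; push_cast; linarith
    have hc : (‖z‖ + (n : ℝ)) ^ n ≤ (‖z‖ + ((n + 1 : ℕ) : ℝ)) ^ n := by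
      gcongr; simp
    gcongr
    exact ih.trans (by gcongr)

theorem continuousOn_Real_Gamma : ContinuousOn Real.Gamma (Ioi 0) := fun x hx =>
  ((Real.differentiableAt_Gamma fun m => by
    have : (0 : ℝ) ≤ m := m.cast_nonneg
    have hx' : 0 < x := hx
    linarith).continuousAt).continuousWithinAt

/-- `Γ(σ + iy) = O((1 + |y|)^N exp (-π|y|/2))`, uniformly for `σ` in a compact subset of `(0, ∞)`.
By the monotonicity of `|Γ(z)| / Γ(Re z)` it is enough to bound `Γ` on a line `Re z = 1/2 + n`. -/
theorem exists_norm_Gamma_le {c₁ : ℝ} (c₂ : ℝ) (h₁ : 0 < c₁) :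
    ∃ (C : ℝ) (N : ℕ), ∀ z : ℂ, c₁ ≤ z.re → z.re ≤ c₂ →
      ‖Complex.Gamma z‖ ≤ C * (1 + |z.im|) ^ N * Real.exp (-(Real.pi / 2) * |z.im|) := by
  obtain ⟨n, hn⟩ := exists_nat_gt c₂
  obtain ⟨M, hM⟩ := (isCompact_Icc (a := c₁) (b := c₂)).exists_bound_of_continuousOn
    (continuousOn_Real_Gamma.mono fun x hx => h₁.trans_le hx.1)
  refine ⟨M / Real.Gamma (1 / 2 + n) * (2 + n) ^ n * Real.sqrt (2 * Real.pi), n, ?_⟩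
  intro z hz₁ hz₂
  have hz : 0 < z.re := h₁.trans_le hz₁
  have hG : 0 < Real.Gamma (1 / 2 + n) := Real.Gamma_pos_of_pos (by positivity)
  have hMz : Real.Gamma z.re ≤ M := (le_abs_self _).trans (hM _ ⟨hz₁, hz₂⟩)
  have hM0 : 0 ≤ M := (Real.Gamma_pos_of_pos hz).le.trans hMz
  have key := norm_Gamma_le_mul_norm_Gamma_add (a := 1 / 2 + n - z.re) hz (by linarith)
  have e1 : z + ((1 / 2 + n - z.re : ℝ) : ℂ) = (1 / 2 + z.im * Complex.I) + n := by
    apply Complex.ext <;> simp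
  rw [e1, show z.re + (1 / 2 + n - z.re) = 1 / 2 + (n : ℝ) by ring] at key
  have h2 := norm_Gamma_add_nat_le (z := 1 / 2 + z.im * Complex.I) (by simp) n
  have h3 : ‖(1 / 2 + z.im * Complex.I : ℂ)‖ + n ≤ (2 + n) * (1 + |z.im|) := by
    have : ‖(1 / 2 + z.im * Complex.I : ℂ)‖ ≤ 1 / 2 + |z.im| := by
      refine (norm_add_le _ _).trans ?_
      simp
    nlinarith [abs_nonneg z.im, mul_nonneg (n.cast_nonneg : (0 : ℝ) ≤ n) (abs_nonneg z.im)]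
  calc ‖Complex.Gamma z‖ ≤ _ := key
    _ ≤ M / Real.Gamma (1 / 2 + n) * (((2 + n) * (1 + |z.im|)) ^ n *
        (Real.sqrt (2 * Real.pi) * Real.exp (-(Real.pi / 2) * |z.im|))) := by
      gcongr
      refine h2.trans ?_
      gcongr
      exact norm_Gamma_half_add_mul_I_le _
    _ = _ := by rw [mul_pow]; ring

/-- `1 / Γ(σ + iy) = O((1 + |y|)^N exp (π|y|/2))`, uniformly for `σ` in a compact subset of
`(0, ∞)`. -/
theorem exists_norm_inv_Gamma_le {c₁ : ℝ} (c₂ : ℝ) (h₁ : 0 < c₁) :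
    ∃ (C : ℝ) (N : ℕ), ∀ z : ℂ, c₁ ≤ z.re → z.re ≤ c₂ →
      ‖(Complex.Gamma z)⁻¹‖ ≤ C * (1 + |z.im|) ^ N * Real.exp ((Real.pi / 2) * |z.im|) := by
  obtain ⟨M, hM⟩ := (isCompact_Icc (a := c₁) (b := c₂)).exists_bound_of_continuousOn
    (f := fun x => (Real.Gamma (x + 1))⁻¹) (by
      refine ContinuousOn.inv₀ (continuousOn_Real_Gamma.comp (by fun_prop) fun x hx => ?_)
        fun x hx => (Real.Gamma_pos_of_pos ?_).ne'
      · have := hx.1; simp only [mem_Ioi]; linarith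
      · have := hx.1; linarith)
  refine ⟨(1 + |c₂|) * (Real.Gamma (1 / 2) * M * (Real.sqrt Real.pi)⁻¹), 1, ?_⟩
  intro z hz₁ hz₂
  have hz : 0 < z.re := h₁.trans_le hz₁
  have hz0 : z ≠ 0 := fun h => by simp [h] at hz
  have hG1 : 0 < Real.Gamma (z.re + 1) := Real.Gamma_pos_of_pos (by linarith)
  have hMz : (Real.Gamma (z.re + 1))⁻¹ ≤ M := (le_abs_self _).trans (hM _ ⟨hz₁, hz₂⟩)
  have hM0 : 0 ≤ M := (inv_pos.mpr hG1).le.trans hMz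
  have hGh : 0 < Real.Gamma (1 / 2) := Real.Gamma_pos_of_pos (by norm_num)
  have key := norm_Gamma_le_mul_norm_Gamma_add (z := 1 / 2 + z.im * Complex.I)
    (a := z.re + 1 / 2) (by simp) (by linarith)
  have hre : (1 / 2 + z.im * Complex.I : ℂ).re = 1 / 2 := by simp
  have e1 : (1 / 2 + z.im * Complex.I) + ((z.re + 1 / 2 : ℝ) : ℂ) = z + 1 := by
    apply Complex.ext <;> simp; ring
  rw [e1, hre, show (1 : ℝ) / 2 + (z.re + 1 / 2) = z.re + 1 by ring] at key
  have hlow := (le_norm_Gamma_half_add_mul_I z.im).trans key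
  have hpos : 0 < ‖Complex.Gamma z‖ := norm_pos_iff.mpr (Complex.Gamma_ne_zero_of_re_pos hz)
  rw [Complex.Gamma_add_one _ hz0, norm_mul] at hlow
  have hzn : ‖z‖ ≤ (1 + |c₂|) * (1 + |z.im|) := by
    refine (norm_le_add_mul_one_add_abs_im z).trans ?_
    gcongr
  have hsp : 0 < Real.sqrt Real.pi := Real.sqrt_pos.mpr Real.pi_pos
  rw [norm_inv, inv_le_iff_one_le_mul₀ hpos]
  have hexp : Real.exp (-(Real.pi / 2) * |z.im|) * Real.exp (Real.pi / 2 * |z.im|) = 1 := by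
    rw [← Real.exp_add]; simp
  calc (1 : ℝ) = (Real.sqrt Real.pi)⁻¹ * (Real.sqrt Real.pi * Real.exp (-(Real.pi / 2) * |z.im|)) *
        Real.exp (Real.pi / 2 * |z.im|) := by
        rw [inv_mul_cancel_left₀ hsp.ne', hexp]
    _ ≤ (Real.sqrt Real.pi)⁻¹ * (Real.Gamma (1 / 2) / Real.Gamma (z.re + 1) *
        (‖z‖ * ‖Complex.Gamma z‖)) * Real.exp (Real.pi / 2 * |z.im|) := by gcongr
    _ ≤ (Real.sqrt Real.pi)⁻¹ * (Real.Gamma (1 / 2) * M *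
        ((1 + |c₂|) * (1 + |z.im|) * ‖Complex.Gamma z‖)) * Real.exp (Real.pi / 2 * |z.im|) := by
      rw [div_eq_mul_inv]; gcongr
    _ = _ := by ring

/-! ### Functions of exponential decay in a strip -/

/-- `K` is holomorphic in the strip `a < Re z < b`, and `K(z) = O((1 + |Im z|)^N exp (-κ |Im z|))`
uniformly on closed substrips. For `κ < 0` this allows exponential growth. -/
structure StripGrowth (K : ℂ → ℂ) (κ a b : ℝ) : Prop where
  differentiableOn : DifferentiableOn ℂ K (Complex.re ⁻¹' Ioo a b)
  bound : ∀ c₁ c₂ : ℝ, a < c₁ → c₂ < b → ∃ (C : ℝ) (N : ℕ), ∀ z : ℂ, c₁ ≤ z.re → z.re ≤ c₂ →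
    ‖K z‖ ≤ C * (1 + |z.im|) ^ N * Real.exp (-κ * |z.im|)

theorem StripGrowth.mul {K L : ℂ → ℂ} {κ l a b : ℝ} (hK : StripGrowth K κ a b)
    (hL : StripGrowth L l a b) : StripGrowth (fun z => K z * L z) (κ + l) a b := by
  refine ⟨hK.differentiableOn.mul hL.differentiableOn, fun c₁ c₂ h₁ h₂ => ?_⟩
  obtain ⟨C, N, hC⟩ := hK.bound c₁ c₂ h₁ h₂
  obtain ⟨D, M, hD⟩ := hL.bound c₁ c₂ h₁ h₂
  refine ⟨C * D, N + M, fun z hz₁ hz₂ => ?_⟩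
  have e : Real.exp (-(κ + l) * |z.im|) = Real.exp (-κ * |z.im|) * Real.exp (-l * |z.im|) := by
    rw [← Real.exp_add]; ring_nf
  calc ‖K z * L z‖ = ‖K z‖ * ‖L z‖ := norm_mul _ _
    _ ≤ (C * (1 + |z.im|) ^ N * Real.exp (-κ * |z.im|)) *
        (D * (1 + |z.im|) ^ M * Real.exp (-l * |z.im|)) :=
      mul_le_mul (hC z hz₁ hz₂) (hD z hz₁ hz₂) (norm_nonneg _)
        ((norm_nonneg _).trans (hC z hz₁ hz₂))
    _ = _ := by rw [e, pow_add]; ring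

theorem StripGrowth.mono {K : ℂ → ℂ} {κ a b a' b' : ℝ} (hK : StripGrowth K κ a b) (ha : a ≤ a')
    (hb : b' ≤ b) : StripGrowth K κ a' b' :=
  ⟨hK.differentiableOn.mono (preimage_mono (Ioo_subset_Ioo ha hb)),
    fun c₁ c₂ h₁ h₂ => hK.bound c₁ c₂ (ha.trans_lt h₁) (h₂.trans_le hb)⟩

theorem stripGrowth_const (w : ℂ) (a b : ℝ) : StripGrowth (fun _ => w) 0 a b :=
  ⟨differentiableOn_const _, fun _ _ _ _ => ⟨‖w‖, 0, fun z _ _ => by simp⟩⟩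

/-- An affine function that is non-negative at both ends of `(a, b)` and positive at one of them lies,
on `[c₁, c₂] ⊆ (a, b)`, between two positive constants. -/
theorem affine_mem_Icc {p q a b c₁ c₂ x : ℝ} (ha : 0 ≤ p + q * a) (hb : 0 ≤ p + q * b)
    (hpq : 0 < p + q * a ∨ 0 < p + q * b) (h₁ : a < c₁) (h₂ : c₂ < b) (hx₁ : c₁ ≤ x)
    (hx₂ : x ≤ c₂) :
    0 < min (p + q * c₁) (p + q * c₂) ∧ min (p + q * c₁) (p + q * c₂) ≤ p + q * x ∧
      p + q * x ≤ max (p + q * c₁) (p + q * c₂) := by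
  rcases lt_trichotomy q 0 with hq | hq | hq
  · have h3 : q * x ≤ q * c₁ := mul_le_mul_of_nonpos_left hx₁ hq.le
    have h4 : q * c₂ ≤ q * x := mul_le_mul_of_nonpos_left hx₂ hq.le
    have h5 : q * b < q * c₂ := mul_lt_mul_of_neg_left h₂ hq
    rw [min_eq_right (by linarith), max_eq_left (by linarith)]
    exact ⟨by linarith, by linarith, by linarith⟩
  · subst hq
    have hp : 0 < p := by simpa using hpq
    simp [hp]
  · have h3 : q * c₁ ≤ q * x := mul_le_mul_of_nonneg_left hx₁ hq.le
    have h4 : q * x ≤ q * c₂ := mul_le_mul_of_nonneg_left hx₂ hq.le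
    have h5 : q * a < q * c₁ := mul_lt_mul_of_pos_left h₁ hq
    rw [min_eq_left (by linarith), max_eq_right (by linarith)]
    exact ⟨by linarith, by linarith, by linarith⟩

theorem affine_re_pos {p q a b : ℝ} (ha : 0 ≤ p + q * a) (hb : 0 ≤ p + q * b)
    (hpq : 0 < p + q * a ∨ 0 < p + q * b) {z : ℂ} (hz : z.re ∈ Ioo a b) :
    0 < (p + q * z : ℂ).re := by
  have h := affine_mem_Icc ha hb hpq hz.1 hz.2 le_rfl le_rfl
  simpa using h.1

/-- Comparison of a power of `1 + |q y|` with one of `1 + |y|`. -/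
theorem one_add_abs_mul_pow_le (q y : ℝ) (N : ℕ) :
    (1 + |q * y|) ^ N ≤ (1 + |q|) ^ N * (1 + |y|) ^ N := by
  rw [← mul_pow]
  gcongr
  rw [abs_mul]
  nlinarith [abs_nonneg q, abs_nonneg y]

/-- `Γ(p + q z)` decays at the rate `π|q|/2` in every strip that `p + q z` maps into the right half
plane. -/
theorem stripGrowth_Gamma {p q a b : ℝ} (ha : 0 ≤ p + q * a) (hb : 0 ≤ p + q * b)
    (hpq : 0 < p + q * a ∨ 0 < p + q * b) :
    StripGrowth (fun z => Complex.Gamma (p + q * z)) (Real.pi / 2 * |q|) a b := by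
  refine ⟨fun z hz => ?_, fun c₁ c₂ h₁ h₂ => ?_⟩
  · have hpos := affine_re_pos ha hb hpq hz
    refine (DifferentiableAt.comp z (Complex.differentiableAt_Gamma _ fun m hm => ?_)
      (by fun_prop)).differentiableWithinAt
    rw [hm] at hpos
    simp at hpos
    linarith [(m.cast_nonneg : (0 : ℝ) ≤ m)]
  · by_cases hc : c₁ ≤ c₂
    swap
    · exact ⟨0, 0, fun z hz₁ hz₂ => absurd (hz₁.trans hz₂) hc⟩
    have hm := (affine_mem_Icc ha hb hpq h₁ h₂ le_rfl hc).1
    obtain ⟨C, N, hC⟩ := exists_norm_Gamma_le (max (p + q * c₁) (p + q * c₂)) hm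
    refine ⟨|C| * (1 + |q|) ^ N, N, fun z hz₁ hz₂ => ?_⟩
    have hz := affine_mem_Icc ha hb hpq h₁ h₂ hz₁ hz₂
    have h := hC (p + q * z) (by simpa using hz.2.1) (by simpa using hz.2.2)
    have him : (p + q * z : ℂ).im = q * z.im := by simp
    rw [him] at h
    refine h.trans ?_
    have h2 := one_add_abs_mul_pow_le q z.im N
    calc _ ≤ |C| * ((1 + |q|) ^ N * (1 + |z.im|) ^ N) *
          Real.exp (-(Real.pi / 2) * |q * z.im|) := by
          gcongr; exact le_abs_self _
      _ = _ := by rw [abs_mul]; ring_nf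

theorem stripGrowth_inv_Gamma {p q a b : ℝ} (ha : 0 ≤ p + q * a) (hb : 0 ≤ p + q * b)
    (hpq : 0 < p + q * a ∨ 0 < p + q * b) :
    StripGrowth (fun z => (Complex.Gamma (p + q * z))⁻¹) (-(Real.pi / 2 * |q|)) a b := by
  refine ⟨?_, fun c₁ c₂ h₁ h₂ => ?_⟩
  · exact (Complex.differentiable_one_div_Gamma.comp (f := fun z : ℂ => p + q * z)
      (by fun_prop)).differentiableOn
  · by_cases hc : c₁ ≤ c₂
    swap
    · exact ⟨0, 0, fun z hz₁ hz₂ => absurd (hz₁.trans hz₂) hc⟩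
    have hm := (affine_mem_Icc ha hb hpq h₁ h₂ le_rfl hc).1
    obtain ⟨C, N, hC⟩ := exists_norm_inv_Gamma_le (max (p + q * c₁) (p + q * c₂)) hm
    refine ⟨|C| * (1 + |q|) ^ N, N, fun z hz₁ hz₂ => ?_⟩
    have hz := affine_mem_Icc ha hb hpq h₁ h₂ hz₁ hz₂
    have h := hC (p + q * z) (by simpa using hz.2.1) (by simpa using hz.2.2)
    have him : (p + q * z : ℂ).im = q * z.im := by simp
    rw [him] at h
    refine h.trans ?_
    have h2 := one_add_abs_mul_pow_le q z.im N
    calc _ ≤ |C| * ((1 + |q|) ^ N * (1 + |z.im|) ^ N) *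
          Real.exp ((Real.pi / 2) * |q * z.im|) := by
          gcongr; exact le_abs_self _
      _ = _ := by rw [abs_mul]; ring_nf

theorem exists_one_add_pow_mul_exp_neg_le {κ : ℝ} (hκ : 0 < κ) (n : ℕ) :
    ∃ C : ℝ, ∀ t : ℝ, 0 ≤ t → (1 + t) ^ n * Real.exp (-κ * t) ≤ C := by
  refine ⟨n.factorial / κ ^ n * Real.exp κ, fun t ht => ?_⟩
  have h := Real.pow_div_factorial_le_exp (x := κ * (1 + t)) (by positivity) n
  rw [mul_pow, div_le_iff₀ (by positivity)] at h
  have h1 : (1 + t) ^ n ≤ n.factorial / κ ^ n * Real.exp (κ * (1 + t)) := by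
    rw [div_mul_eq_mul_div, le_div_iff₀ (by positivity)]
    linarith
  calc _ ≤ n.factorial / κ ^ n * Real.exp (κ * (1 + t)) * Real.exp (-κ * t) := by gcongr
    _ = _ := by rw [mul_assoc, ← Real.exp_add]; ring_nf

theorem integrable_exp_neg_mul_abs {κ : ℝ} (hκ : 0 < κ) :
    Integrable fun u : ℝ => Real.exp (-κ * |u|) := by
  obtain ⟨C, hC⟩ := exists_one_add_pow_mul_exp_neg_le hκ 2
  refine (integrable_inv_one_add_sq.const_mul C).mono'
    (by fun_prop) (ae_of_all _ fun u => ?_)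
  rw [Real.norm_of_nonneg (Real.exp_pos _).le, ← div_eq_mul_inv, le_div_iff₀ (by positivity)]
  refine le_trans ?_ (hC |u| (abs_nonneg u))
  rw [mul_comm]
  gcongr
  nlinarith [abs_nonneg u, sq_abs u]

theorem stripGrowth_id (a b : ℝ) : StripGrowth (fun z => z) 0 a b := by
  refine ⟨differentiableOn_id, fun c₁ c₂ _ _ => ⟨1 + max |c₁| |c₂|, 1, fun z hz₁ hz₂ => ?_⟩⟩
  have := norm_le_add_mul_one_add_abs_im z
  have h2 : |z.re| ≤ max |c₁| |c₂| := abs_le_max_abs_abs hz₁ hz₂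
  simp only [neg_zero, zero_mul, Real.exp_zero, mul_one, pow_one]
  exact this.trans (by gcongr)

theorem StripGrowth.congr {K L : ℂ → ℂ} {κ a b : ℝ} (hK : StripGrowth K κ a b)
    (h : ∀ z : ℂ, a < z.re → z.re < b → L z = K z) : StripGrowth L κ a b := by
  refine ⟨hK.differentiableOn.congr fun z hz => h z hz.1 hz.2, fun c₁ c₂ h₁ h₂ => ?_⟩
  obtain ⟨C, N, hC⟩ := hK.bound c₁ c₂ h₁ h₂
  refine ⟨C, N, fun z hz₁ hz₂ => ?_⟩
  rw [h z (h₁.trans_le hz₁) (hz₂.trans_lt h₂)]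
  exact hC z hz₁ hz₂

namespace StripGrowth

variable {K : ℂ → ℂ} {κ a b : ℝ}

theorem id_mul (hK : StripGrowth K κ a b) : StripGrowth (fun z => z * K z) κ a b := by
  simpa using (stripGrowth_id a b).mul hK

theorem continuous_line (hK : StripGrowth K κ a b) {c : ℝ} (hc : c ∈ Ioo a b) :
    Continuous fun y : ℝ => K (c + y * Complex.I) := by
  have : IsOpen (Complex.re ⁻¹' Ioo a b) := isOpen_Ioo.preimage Complex.continuous_re
  refine continuous_iff_continuousAt.mpr fun y => ?_
  have hmem : (c + y * Complex.I : ℂ) ∈ Complex.re ⁻¹' Ioo a b := by simpa using hc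
  exact ContinuousAt.comp (g := K) (f := fun y : ℝ => (c + y * Complex.I : ℂ))
    (hK.differentiableOn.continuousOn.continuousAt (this.mem_nhds hmem)) (by fun_prop)

theorem exists_pow_mul_norm_le (hK : StripGrowth K κ a b) (hκ : 0 < κ) (n : ℕ) {c₁ c₂ : ℝ}
    (h₁ : a < c₁) (h₂ : c₂ < b) :
    ∃ C : ℝ, ∀ z : ℂ, c₁ ≤ z.re → z.re ≤ c₂ → (1 + |z.im|) ^ n * ‖K z‖ ≤ C := by
  obtain ⟨C, N, hC⟩ := hK.bound c₁ c₂ h₁ h₂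
  obtain ⟨D, hD⟩ := exists_one_add_pow_mul_exp_neg_le hκ (n + N)
  refine ⟨|C| * D, fun z hz₁ hz₂ => ?_⟩
  calc _ ≤ (1 + |z.im|) ^ n * (|C| * (1 + |z.im|) ^ N * Real.exp (-κ * |z.im|)) := by
        gcongr
        exact (hC z hz₁ hz₂).trans (by gcongr; exact le_abs_self C)
    _ = |C| * ((1 + |z.im|) ^ (n + N) * Real.exp (-κ * |z.im|)) := by rw [pow_add]; ring
    _ ≤ _ := by gcongr; exact hD _ (abs_nonneg _)

theorem verticalIntegrable (hK : StripGrowth K κ a b) (hκ : 0 < κ) {c : ℝ} (hc : c ∈ Ioo a b) :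
    Complex.VerticalIntegrable K c := by
  obtain ⟨C, hC⟩ := hK.exists_pow_mul_norm_le hκ 2 hc.1 hc.2
  refine (integrable_inv_one_add_sq.const_mul C).mono'
    (hK.continuous_line hc).aestronglyMeasurable (ae_of_all _ fun y => ?_)
  rw [← div_eq_mul_inv, le_div_iff₀ (by positivity)]
  have h := hC (c + y * Complex.I) (by simp) (by simp)
  have him : (c + y * Complex.I : ℂ).im = y := by simp
  rw [him] at h
  refine le_trans ?_ h
  rw [mul_comm]
  gcongr
  nlinarith [abs_nonneg y, sq_abs y]

end StripGrowth

/-! ### The inverse Mellin transform along vertical lines -/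

theorem mellinInv_eq (c : ℝ) (K : ℂ → ℂ) (x : ℝ) :
    mellinInv c K x = (1 / (2 * Real.pi) : ℝ) *
      ∫ y : ℝ, (x : ℂ) ^ (-(c + y * Complex.I)) * K (c + y * Complex.I) := by
  simp [mellinInv, Complex.real_smul]

theorem mellinInv_congr {c : ℝ} {K L : ℂ → ℂ} (h : ∀ z : ℂ, z.re = c → K z = L z) :
    mellinInv c K = mellinInv c L := by
  funext x
  simp only [mellinInv]
  congr 2
  funext y
  rw [h _ (by simp)]

theorem mellinInv_add {c d : ℝ} {K : ℂ → ℂ} {x : ℝ} (hx : 0 < x) :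
    mellinInv (c + d) K x = ((x ^ (-d) : ℝ) : ℂ) * mellinInv c (fun z => K (z + d)) x := by
  have hx0 : (x : ℂ) ≠ 0 := Complex.ofReal_ne_zero.mpr hx.ne'
  rw [mellinInv_eq, mellinInv_eq, mul_left_comm]
  congr 1
  rw [← integral_const_mul]
  congr 1
  funext y
  rw [Complex.ofReal_cpow hx.le, ← mul_assoc, ← Complex.cpow_add _ _ hx0]
  congr 2
  · push_cast; ring
  · push_cast; ring_nf

theorem mellinInv_const_mul (c : ℝ) (w : ℂ) (K : ℂ → ℂ) (x : ℝ) :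
    mellinInv c (fun z => w * K z) x = w * mellinInv c K x := by
  rw [mellinInv_eq, mellinInv_eq, mul_left_comm]
  congr 1
  rw [← integral_const_mul]
  congr 1
  funext y
  ring

theorem norm_mellinInv_le {c : ℝ} (K : ℂ → ℂ) {x : ℝ} (hx : 0 < x) :
    ‖mellinInv c K x‖ ≤
      (1 / (2 * Real.pi) * ∫ y : ℝ, ‖K (c + y * Complex.I)‖) * x ^ (-c) := by
  rw [mellinInv_eq, norm_mul, Complex.norm_real, Real.norm_of_nonneg (by positivity), mul_assoc]
  gcongr
  refine (norm_integral_le_integral_norm _).trans_eq ?_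
  rw [← integral_mul_const]
  congr 1
  funext y
  rw [norm_mul, Complex.norm_cpow_eq_rpow_re_of_pos hx, mul_comm]
  simp

theorem conj_mellinInv {c : ℝ} {K : ℂ → ℂ}
    (hK : ∀ z, K ((starRingEnd ℂ) z) = (starRingEnd ℂ) (K z)) {x : ℝ} (hx : 0 < x) :
    (starRingEnd ℂ) (mellinInv c K x) = mellinInv c K x := by
  have harg : (x : ℂ).arg ≠ Real.pi := by
    rw [Complex.arg_ofReal_of_nonneg hx.le]; exact Real.pi_pos.ne
  rw [mellinInv_eq, map_mul, Complex.conj_ofReal, ← integral_conj, ← integral_neg_eq_self]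
  congr 2
  funext y
  have e : (starRingEnd ℂ) (c + ((-y : ℝ) : ℂ) * Complex.I) = c + y * Complex.I := by
    simp
  have hpow (n : ℂ) : (starRingEnd ℂ) ((x : ℂ) ^ n) = (x : ℂ) ^ (starRingEnd ℂ) n := by
    rw [Complex.cpow_conj _ _ harg, Complex.conj_ofReal]
  rw [map_mul, ← hK, hpow, map_neg, e]

theorem ofReal_re_mellinInv {c : ℝ} {K : ℂ → ℂ}
    (hK : ∀ z, K ((starRingEnd ℂ) z) = (starRingEnd ℂ) (K z)) {x : ℝ} (hx : 0 < x) :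
    ((mellinInv c K x).re : ℂ) = mellinInv c K x :=
  Complex.conj_eq_iff_re.mp (conj_mellinInv hK hx)

/-- Cauchy's theorem: the line of integration may be moved within the strip. The integrals over the
horizontal sides of the rectangles with vertices `c ± iT`, `c' ± iT` vanish as `T → ∞`. -/
theorem StripGrowth.mellinInv_eq_mellinInv {K : ℂ → ℂ} {κ a b : ℝ} (hK : StripGrowth K κ a b)
    (hκ : 0 < κ) {c c' : ℝ} (hc : c ∈ Ioo a b) (hc' : c' ∈ Ioo a b) {x : ℝ} (hx : 0 < x) :
    mellinInv c K x = mellinInv c' K x := by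
  have hx0 : (x : ℂ) ≠ 0 := Complex.ofReal_ne_zero.mpr hx.ne'
  have hsub : uIcc c c' ⊆ Ioo a b := (convex_Ioo a b).ordConnected.uIcc_subset hc hc'
  set f : ℂ → ℂ := fun z => (x : ℂ) ^ (-z) * K z with hf
  have hdiff : DifferentiableOn ℂ f (Complex.re ⁻¹' Ioo a b) := by
    refine DifferentiableOn.mul (fun z _ => ?_) hK.differentiableOn
    exact ((differentiableAt_id.neg).const_cpow (Or.inl hx0)).differentiableWithinAt
  have hline : ∀ d ∈ Ioo a b, Integrable fun y : ℝ => f (d + y * Complex.I) := by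
    intro d hd
    refine (hK.verticalIntegrable hκ hd).bdd_mul (c := x ^ (-d)) ?_ (ae_of_all _ fun y => ?_)
    · refine Continuous.aestronglyMeasurable ?_
      exact Continuous.const_cpow (by fun_prop) (Or.inl hx0)
    · rw [Complex.norm_cpow_eq_rpow_re_of_pos hx]; simp
  obtain ⟨C, hC⟩ := hK.exists_pow_mul_norm_le hκ 1
    (c₁ := min c c') (c₂ := max c c') (lt_min hc.1 hc'.1) (max_lt hc.2 hc'.2)
  obtain ⟨M, hM⟩ := (isCompact_uIcc (a := c) (b := c')).exists_bound_of_continuousOn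
    (f := fun s : ℝ => x ^ (-s)) (by
      refine ContinuousOn.rpow continuousOn_const (by fun_prop) fun s _ => Or.inl hx.ne')
  have hhor : ∀ T : ℝ, ‖∫ s : ℝ in c..c', f (s + T * Complex.I)‖ ≤
      M * C * |c' - c| / (1 + |T|) := by
    intro T
    have := intervalIntegral.norm_integral_le_of_norm_le_const (a := c) (b := c')
      (f := fun s : ℝ => f (s + T * Complex.I)) (C := M * (C / (1 + |T|))) (fun s hs => by
        have hs' : s ∈ uIcc c c' := uIoc_subset_uIcc hs
        have h1 := hC (s + T * Complex.I) (by simpa using hs'.1) (by simpa using hs'.2)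
        have h2 := hM s hs'
        simp only [Complex.add_im, Complex.ofReal_im, Complex.mul_im, Complex.ofReal_re,
          Complex.I_im, mul_one, Complex.I_re, mul_zero, add_zero, zero_add, pow_one] at h1
        rw [hf, norm_mul, Complex.norm_cpow_eq_rpow_re_of_pos hx]
        have h3 : (-(s + T * Complex.I : ℂ)).re = -s := by simp
        rw [h3]
        refine mul_le_mul ((le_abs_self _).trans h2) ?_ (norm_nonneg _)
          ((norm_nonneg _).trans h2)
        rw [le_div_iff₀ (by positivity), mul_comm]
        exact h1)
    calc _ ≤ _ := this
      _ = _ := by ring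
  have hlim : ∀ g : ℝ → ℝ, Tendsto (fun T => |g T|) atTop atTop →
      Tendsto (fun T => ∫ s : ℝ in c..c', f (s + (g T : ℝ) * Complex.I)) atTop (𝓝 0) := by
    intro g hg
    refine squeeze_zero_norm (fun T => hhor (g T)) ?_
    exact Tendsto.div_atTop tendsto_const_nhds (tendsto_atTop_add_const_left _ _ hg)
  have hrect : ∀ T : ℝ, (∫ s : ℝ in c..c', f (s + ((-T : ℝ) : ℂ) * Complex.I)) -
      (∫ s : ℝ in c..c', f (s + (T : ℂ) * Complex.I)) +
      Complex.I * (∫ y : ℝ in (-T)..T, f (c' + y * Complex.I)) -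
      Complex.I * (∫ y : ℝ in (-T)..T, f (c + y * Complex.I)) = 0 := by
    intro T
    have := Complex.integral_boundary_rect_eq_zero_of_differentiableOn f
      ⟨c, -T⟩ ⟨c', T⟩ (hdiff.mono fun z hz => hsub hz.1)
    simpa using this
  have hI := fun d hd => intervalIntegral_tendsto_integral (hline d hd)
    (tendsto_neg_atTop_atBot (G := ℝ)) tendsto_id
  have hfin := (((hlim (fun T => -T) (by simpa using tendsto_abs_atTop_atTop)).sub
    (hlim id (by simpa using tendsto_abs_atTop_atTop))).add
    ((hI c' hc').const_mul Complex.I)).sub ((hI c hc).const_mul Complex.I)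
  have h0 := tendsto_nhds_unique hfin (tendsto_const_nhds.congr fun T => (hrect T).symm)
  rw [mellinInv_eq, mellinInv_eq]
  congr 1
  have h1 : Complex.I * (∫ y : ℝ, f (c' + y * Complex.I)) =
      Complex.I * ∫ y : ℝ, f (c + y * Complex.I) := by
    linear_combination h0
  exact (mul_left_cancel₀ Complex.I_ne_zero h1).symm

theorem hasDerivAt_ofReal_cpow {y : ℝ} (hy : 0 < y) (r : ℂ) :
    HasDerivAt (fun s : ℝ => (s : ℂ) ^ r) (r * (y : ℂ) ^ (r - 1)) y := by
  have h := (hasDerivAt_id (y : ℂ)).cpow_const (c := r) (Or.inl (by simpa using hy))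
  simpa using h.comp_ofReal

/-- The Mellin-Barnes integral of a scaled argument, as a superposition of powers. -/
theorem rpow_mul_mellinInv {c p r a y : ℝ} {K : ℂ → ℂ} (ha : 0 < a) (hy : 0 < y) :
    ((y ^ p : ℝ) : ℂ) * mellinInv c K (a * y ^ r) = (1 / (2 * Real.pi) : ℝ) *
      ∫ v : ℝ, (a : ℂ) ^ (-(c + v * Complex.I)) * K (c + v * Complex.I) *
        (y : ℂ) ^ (p - r * (c + v * Complex.I)) := by
  have hy0 : (y : ℂ) ≠ 0 := Complex.ofReal_ne_zero.mpr hy.ne'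
  rw [mellinInv_eq, mul_left_comm]
  congr 1
  rw [← integral_const_mul]
  congr 1
  funext v
  rw [Complex.ofReal_mul, Complex.mul_cpow_ofReal_nonneg ha.le (Real.rpow_nonneg hy.le _),
    Complex.ofReal_cpow hy.le, Complex.ofReal_cpow hy.le, sub_eq_add_neg,
    Complex.cpow_add _ _ hy0, ← mul_neg, Complex.cpow_mul_ofReal_nonneg hy.le,
    Complex.ofReal_cpow hy.le]
  ring

theorem continuous_const_cpow_line {x : ℝ} (hx : 0 < x) (u w : ℂ) :
    Continuous fun v : ℝ => (x : ℂ) ^ (u + v * w) :=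
  Continuous.const_cpow (by fun_prop) (Or.inl (Complex.ofReal_ne_zero.mpr hx.ne'))

theorem norm_cpow_line {x : ℝ} (hx : 0 < x) (c p r v : ℝ) :
    ‖(x : ℂ) ^ (p - r * (c + v * Complex.I) : ℂ)‖ = x ^ (p - r * c) := by
  rw [Complex.norm_cpow_eq_rpow_re_of_pos hx]; simp

theorem norm_cpow_neg_line {x : ℝ} (hx : 0 < x) (c v : ℝ) :
    ‖(x : ℂ) ^ (-(c + v * Complex.I) : ℂ)‖ = x ^ (-c) := by
  rw [Complex.norm_cpow_eq_rpow_re_of_pos hx]; simp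

theorem integrable_cpow_mul {c a : ℝ} {K : ℂ → ℂ} (ha : 0 < a)
    (hK : Complex.VerticalIntegrable K c) :
    Integrable fun v : ℝ => (a : ℂ) ^ (-(c + v * Complex.I)) * K (c + v * Complex.I) := by
  refine Integrable.bdd_mul (c := a ^ (-c)) hK ?_ (ae_of_all _ fun v =>
    (norm_cpow_neg_line ha c v).le)
  have := continuous_const_cpow_line ha (-c) (-Complex.I)
  refine Continuous.aestronglyMeasurable ?_
  convert this using 3
  ring

/-- The derivative of a Mellin-Barnes integral is computed under the integral sign. -/
theorem hasDerivAt_rpow_mul_mellinInv {c p r a y : ℝ} {K : ℂ → ℂ} (ha : 0 < a) (hy : 0 < y)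
    (hK : Complex.VerticalIntegrable K c)
    (hzK : Complex.VerticalIntegrable (fun z => z * K z) c) :
    HasDerivAt (fun s : ℝ => ((s ^ p : ℝ) : ℂ) * mellinInv c K (a * s ^ r))
      (((y ^ (p - 1) : ℝ) : ℂ) * mellinInv c (fun z => (p - r * z) * K z) (a * y ^ r)) y := by
  have hL : Complex.VerticalIntegrable (fun z => (p - r * z) * K z) c := by
    have := (hK.const_mul (p : ℂ)).sub (hzK.const_mul (r : ℂ))
    refine this.congr (ae_of_all _ fun v => ?_)
    simp only [Pi.sub_apply]
    ring
  have hpos : ∀ s ∈ Ioo (y / 2) (2 * y), 0 < s := fun s hs => (half_pos hy).trans hs.1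
  obtain ⟨M, hM⟩ := (isCompact_Icc (a := y / 2) (b := 2 * y)).exists_bound_of_continuousOn
    (f := fun s : ℝ => s ^ (p - 1 - r * c)) (by
      refine ContinuousOn.rpow_const continuousOn_id fun s hs => Or.inl ?_
      exact ((half_pos hy).trans_le hs.1).ne')
  have hmeas (q : ℝ) (s : ℝ) (hs : 0 < s) {L : ℂ → ℂ} (hL : Complex.VerticalIntegrable L c) :
      Integrable (fun v : ℝ => (a : ℂ) ^ (-(c + v * Complex.I)) * L (c + v * Complex.I) *
        (s : ℂ) ^ (q - r * (c + v * Complex.I))) := by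
    have h1 := integrable_cpow_mul ha hL
    have h2 := continuous_const_cpow_line hs (q - r * c) (-r * Complex.I)
    have := h1.bdd_mul (c := s ^ (q - r * c))
      (f := fun v : ℝ => (s : ℂ) ^ (q - r * (c + v * Complex.I))) (by
        refine Continuous.aestronglyMeasurable ?_
        convert h2 using 3
        ring) (ae_of_all _ fun v => (norm_cpow_line hs c q r v).le)
    refine this.congr (ae_of_all _ fun v => mul_comm _ _)
  have key := (hasDerivAt_integral_of_dominated_loc_of_deriv_le (μ := volume)
    (F := fun (s : ℝ) (v : ℝ) => (a : ℂ) ^ (-(c + v * Complex.I)) * K (c + v * Complex.I) *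
        (s : ℂ) ^ (p - r * (c + v * Complex.I)))
    (F' := fun (s : ℝ) (v : ℝ) => (a : ℂ) ^ (-(c + v * Complex.I)) *
        ((p - r * (c + v * Complex.I)) * K (c + v * Complex.I)) *
        (s : ℂ) ^ (((p - 1 : ℝ) : ℂ) - r * (c + v * Complex.I)))
    (bound := fun v : ℝ => ‖(a : ℂ) ^ (-(c + v * Complex.I)) *
        ((p - r * (c + v * Complex.I)) * K (c + v * Complex.I))‖ * M)
    (x₀ := y) (s := Ioo (y / 2) (2 * y)) (Ioo_mem_nhds (by linarith) (by linarith))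
    ?_ (hmeas p y hy hK) (hmeas (p - 1) y hy hL).aestronglyMeasurable ?_ ?_ ?_).2
  · rw [rpow_mul_mellinInv ha hy]
    refine (key.const_mul ((1 / (2 * Real.pi) : ℝ) : ℂ)).congr_of_eventuallyEq ?_
    filter_upwards [lt_mem_nhds hy] with s hs
    exact rpow_mul_mellinInv ha hs
  · filter_upwards [lt_mem_nhds hy] with s hs
    exact (hmeas p s hs hK).aestronglyMeasurable
  · refine ae_of_all _ fun v s hs => ?_
    rw [norm_mul, norm_cpow_line (hpos s hs)]
    gcongr
    exact (le_abs_self _).trans (hM s (Ioo_subset_Icc_self hs))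
  · exact (integrable_cpow_mul ha hL).norm.mul_const M
  · refine ae_of_all _ fun v s hs => ?_
    have h := (hasDerivAt_ofReal_cpow (hpos s hs) (p - r * (c + v * Complex.I))).const_mul
      ((a : ℂ) ^ (-(c + v * Complex.I)) * K (c + v * Complex.I))
    refine h.congr_deriv ?_
    rw [Complex.ofReal_sub, Complex.ofReal_one, sub_right_comm]
    ring

theorem continuousOn_mellinInv {c : ℝ} {K : ℂ → ℂ} (hK : Complex.VerticalIntegrable K c)
    (hzK : Complex.VerticalIntegrable (fun z => z * K z) c) :
    ContinuousOn (mellinInv c K) (Ioi 0) := by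
  intro y hy
  have h := (hasDerivAt_rpow_mul_mellinInv (p := 0) (r := 1) one_pos hy hK hzK).continuousAt
  refine ContinuousAt.continuousWithinAt (h.congr ?_)
  exact Eventually.of_forall fun s => by simp

namespace StripGrowth

variable {K : ℂ → ℂ} {κ a b : ℝ}

theorem continuousOn_mellinInv (hK : StripGrowth K κ a b) (hκ : 0 < κ) {c : ℝ}
    (hc : c ∈ Ioo a b) : ContinuousOn (mellinInv c K) (Ioi 0) :=
  _root_.continuousOn_mellinInv (hK.verticalIntegrable hκ hc) (hK.id_mul.verticalIntegrable hκ hc)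

/-- Moving the line of integration shows that the inverse Mellin transform is `O(x^{-d})` for every
`d` in the strip. -/
theorem exists_norm_mellinInv_le (hK : StripGrowth K κ a b) (hκ : 0 < κ) {c d : ℝ}
    (hc : c ∈ Ioo a b) (hd : d ∈ Ioo a b) :
    ∃ C : ℝ, ∀ x : ℝ, 0 < x → ‖mellinInv c K x‖ ≤ C * x ^ (-d) :=
  ⟨_, fun x hx => by
    rw [hK.mellinInv_eq_mellinInv hκ hc hd hx]
    exact norm_mellinInv_le K hx⟩

theorem mellinConvergent_mellinInv (hK : StripGrowth K κ a b) (hκ : 0 < κ) {c : ℝ} {s : ℂ}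
    (hc : c ∈ Ioo a b) (hs : s.re ∈ Ioo a b) : MellinConvergent (mellinInv c K) s := by
  obtain ⟨d₁, h₁, h₁'⟩ := exists_between hs.1
  obtain ⟨d₂, h₂, h₂'⟩ := exists_between hs.2
  obtain ⟨C₁, hC₁⟩ := hK.exists_norm_mellinInv_le hκ hc (d := d₁) ⟨h₁, h₁'.trans hs.2⟩
  obtain ⟨C₂, hC₂⟩ := hK.exists_norm_mellinInv_le hκ hc (d := d₂) ⟨hs.1.trans h₂, h₂'⟩
  refine mellinConvergent_of_isBigO_rpow (a := d₂) (b := d₁)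
    ((hK.continuousOn_mellinInv hκ hc).locallyIntegrableOn measurableSet_Ioi) ?_ h₂ ?_ h₁'
  · refine Asymptotics.IsBigO.of_bound C₂ ?_
    filter_upwards [eventually_gt_atTop 0] with x hx
    rw [Real.norm_of_nonneg (Real.rpow_nonneg hx.le _)]
    exact hC₂ x hx
  · refine Asymptotics.IsBigO.of_bound C₁ ?_
    filter_upwards [self_mem_nhdsWithin] with x hx
    have hx' : 0 < x := hx
    rw [Real.norm_of_nonneg (Real.rpow_nonneg hx'.le _)]
    exact hC₁ x hx

open scoped FourierTransform in
/-- The Mellin transform inverts the Mellin-Barnes integral; this is Fourier inversion on the line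
through `s`. -/
theorem mellin_mellinInv (hK : StripGrowth K κ a b) (hκ : 0 < κ) {c : ℝ} {s : ℂ}
    (hc : c ∈ Ioo a b) (hs : s.re ∈ Ioo a b) : mellin (mellinInv c K) s = K s := by
  have hpi : (2 * Real.pi) ≠ 0 := by positivity
  set g : ℝ → ℂ := fun y => K (s.re + 2 * Real.pi * y * Complex.I) with hg
  have hg' : g = fun y => (fun v : ℝ => K (s.re + v * Complex.I)) (2 * Real.pi * y) := by
    funext y; simp [hg]
  have hgc : Continuous g := by
    rw [hg']; exact (hK.continuous_line hs).comp (by fun_prop)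
  have hgi : Integrable g := by
    rw [hg']; exact (hK.verticalIntegrable hκ hs).comp_mul_left' hpi
  have hinv (u : ℝ) : 𝓕⁻ g u = Real.exp (-s.re * u) • mellinInv c K (Real.exp (-u)) := by
    rw [hK.mellinInv_eq_mellinInv hκ hc hs (Real.exp_pos _),
      mellinInv_eq_fourierInv _ _ (Real.exp_pos _), Real.log_exp, neg_neg,
      ← Complex.ofReal_neg, ← Complex.ofReal_cpow (Real.exp_pos _).le, ← Real.exp_mul,
      Complex.real_smul, smul_eq_mul, ← mul_assoc, ← Complex.ofReal_mul, ← Real.exp_add]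
    simp [hg, mul_comm u]
  have hFi : Integrable (𝓕 g) := by
    obtain ⟨δ, hδ, hδ₁, hδ₂⟩ : ∃ δ > 0, s.re - δ ∈ Ioo a b ∧ s.re + δ ∈ Ioo a b := by
      refine ⟨min (s.re - a) (b - s.re) / 2, ?_, ?_, ?_⟩
      · have := lt_min (sub_pos.mpr hs.1) (sub_pos.mpr hs.2); linarith
      all_goals
        have := lt_min (sub_pos.mpr hs.1) (sub_pos.mpr hs.2)
        have h1 := min_le_left (s.re - a) (b - s.re)
        have h2 := min_le_right (s.re - a) (b - s.re)
        constructor <;> linarith [hs.1, hs.2]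
    obtain ⟨C₁, hC₁⟩ := hK.exists_norm_mellinInv_le hκ hc hδ₁
    obtain ⟨C₂, hC₂⟩ := hK.exists_norm_mellinInv_le hκ hc hδ₂
    have hcont : Continuous (𝓕 g) :=
      VectorFourier.fourierIntegral_continuous Real.continuous_fourierChar
        (innerSL ℝ).continuous₂ hgi
    refine ((integrable_exp_neg_mul_abs hδ).const_mul (max C₁ C₂)).mono'
      hcont.aestronglyMeasurable (ae_of_all _ fun v => ?_)
    obtain ⟨u, rfl⟩ : ∃ u, v = -u := ⟨-v, by simp⟩
    rw [← Real.fourierInv_eq_fourier_neg, hinv, norm_smul, Real.norm_of_nonneg (Real.exp_pos _).le,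
      abs_neg]
    have hpow (d : ℝ) : Real.exp (-s.re * u) * Real.exp (-u) ^ (-d) = Real.exp ((d - s.re) * u) := by
      rw [← Real.exp_mul, ← Real.exp_add]; ring_nf
    rcases le_total 0 u with hu | hu
    · refine (mul_le_mul_of_nonneg_left (hC₁ _ (Real.exp_pos _)) (Real.exp_pos _).le).trans ?_
      rw [mul_left_comm, hpow, abs_of_nonneg hu, sub_sub_cancel_left]
      gcongr
      exact le_max_left _ _
    · refine (mul_le_mul_of_nonneg_left (hC₂ _ (Real.exp_pos _)) (Real.exp_pos _).le).trans ?_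
      rw [mul_left_comm, hpow, abs_of_nonpos hu, add_sub_cancel_left, neg_mul_neg]
      gcongr
      exact le_max_right _ _
  rw [mellin_eq_fourier, ← funext hinv, hgi.fourier_fourierInv_eq hFi hgc.continuousAt, hg]
  conv_rhs => rw [← Complex.re_add_im s]
  push_cast
  field_simp

end StripGrowth

/-- Fubini for a Mellin-Barnes integral: integrating `mellinInv c A (a s^{-r})` against `φ(s) ds / s`
multiplies the kernel by the Mellin transform of `φ`. -/
theorem mellinInv_convolution {c r a : ℝ} {A : ℂ → ℂ} {φ : ℝ → ℂ} (ha : 0 < a)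
    (hA : Complex.VerticalIntegrable A c)
    (hφ : MellinConvergent φ ((r * c : ℝ) : ℂ)) :
    IntegrableOn (fun s : ℝ => mellinInv c A (a * s ^ (-r)) * φ s * (s : ℂ)⁻¹) (Ioi 0) ∧
      ∫ s in Ioi (0 : ℝ), mellinInv c A (a * s ^ (-r)) * φ s * (s : ℂ)⁻¹ =
        mellinInv c (fun z => A z * mellin φ (r * z)) a := by
  set G : ℝ → ℝ → ℂ := fun s v => (a : ℂ) ^ (-(c + v * Complex.I)) * A (c + v * Complex.I) *
    ((s : ℂ) ^ (r * (c + v * Complex.I) - 1) * φ s) with hG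
  have hint : Integrable (Function.uncurry G) ((volume.restrict (Ioi 0)).prod volume) := by
    have h0 := hφ.mul_prod (integrable_cpow_mul ha hA)
    have h1 := h0.bdd_mul (c := 1)
      (f := fun p : ℝ × ℝ => ((p.1 : ℂ) ^ (r * (p.2 * Complex.I)))) (by
        exact Measurable.aestronglyMeasurable (by fun_prop)) (by
        have : ∀ᵐ p : ℝ × ℝ ∂((volume.restrict (Ioi (0 : ℝ))).prod volume), 0 < p.1 := by
          refine Measure.quasiMeasurePreserving_fst.ae (p := fun s : ℝ => 0 < s) ?_
          exact ae_restrict_mem measurableSet_Ioi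
        filter_upwards [this] with p hp
        rw [Complex.norm_cpow_eq_rpow_re_of_pos hp]
        simp)
    refine h1.congr ?_
    have : ∀ᵐ p : ℝ × ℝ ∂((volume.restrict (Ioi (0 : ℝ))).prod volume), 0 < p.1 := by
      refine Measure.quasiMeasurePreserving_fst.ae (p := fun s : ℝ => 0 < s) ?_
      exact ae_restrict_mem measurableSet_Ioi
    filter_upwards [this] with p hp
    have hp0 : (p.1 : ℂ) ≠ 0 := Complex.ofReal_ne_zero.mpr hp.ne'
    have e : (p.1 : ℂ) ^ (r * (c + p.2 * Complex.I) - 1) =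
        (p.1 : ℂ) ^ (r * (p.2 * Complex.I)) * (p.1 : ℂ) ^ (((r * c : ℝ) : ℂ) - 1) := by
      rw [← Complex.cpow_add _ _ hp0]
      congr 1
      push_cast
      ring
    simp only [Function.uncurry, hG, e, smul_eq_mul]
    ring
  have hinner : ∀ s : ℝ, 0 < s → (∫ v, G s v) * (1 / (2 * Real.pi) : ℝ) =
      mellinInv c A (a * s ^ (-r)) * φ s * (s : ℂ)⁻¹ := by
    intro s hs
    have hs0 : (s : ℂ) ≠ 0 := Complex.ofReal_ne_zero.mpr hs.ne'
    have h := rpow_mul_mellinInv (c := c) (p := 0) (r := -r) (K := A) ha hs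
    rw [Real.rpow_zero, Complex.ofReal_one, one_mul] at h
    rw [h, mul_comm, mul_assoc, mul_assoc]
    congr 1
    rw [← integral_mul_const]
    congr 1
    funext v
    have e : (s : ℂ) ^ (r * (c + v * Complex.I) - 1) =
        (s : ℂ) ^ (((0 : ℝ) : ℂ) - ((-r : ℝ) : ℂ) * (c + v * Complex.I)) * (s : ℂ)⁻¹ := by
      rw [← Complex.cpow_neg_one, ← Complex.cpow_add _ _ hs0]
      congr 1
      push_cast
      ring
    simp only [hG, e]
    ring
  constructor
  · refine (hint.integral_prod_left.mul_const ((1 / (2 * Real.pi) : ℝ) : ℂ)).congr ?_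
    filter_upwards [ae_restrict_mem measurableSet_Ioi] with s hs
    exact hinner s hs
  · rw [← setIntegral_congr_fun measurableSet_Ioi fun s hs => hinner s hs, integral_mul_const,
      integral_integral_swap hint, mellinInv_eq, mul_comm]
    congr 2
    funext v
    simp only [hG]
    rw [integral_const_mul, mellin]
    simp only [smul_eq_mul]
    ring

/-! ### The left fractional derivative of a Mellin-Barnes integral -/

theorem integrableOn_sub_rpow_mul_rpow {α q y : ℝ} (hα : α < 1) (hq : -1 < q) (hy : 0 < y) :
    IntegrableOn (fun s : ℝ => (y - s) ^ (-α) * s ^ q) (Ioo 0 y) := by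
  have h := (Complex.betaIntegral_convergent (u := ((q + 1 : ℝ) : ℂ)) (v := ((1 - α : ℝ) : ℂ))
    (by simp; linarith) (by simp; linarith)).norm
  have h2 := h.comp_mul_left (c := y⁻¹) enorm_ne_top enorm_ne_top
  rw [zero_div, one_div, inv_inv, intervalIntegrable_iff_integrableOn_Ioo_of_le hy.le] at h2
  refine IntegrableOn.congr_fun (h2.const_mul (y ^ (-α) * y ^ q)) (fun s hs => ?_)
    measurableSet_Ioo
  have hs1 : 0 < y⁻¹ * s := mul_pos (inv_pos.mpr hy) hs.1
  have hs2 : 0 < 1 - y⁻¹ * s := by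
    rw [sub_pos, inv_mul_lt_iff₀ hy]; simpa using hs.2
  have e : (1 : ℂ) - ((y⁻¹ * s : ℝ) : ℂ) = ((1 - y⁻¹ * s : ℝ) : ℂ) := by push_cast; ring
  have e1 : (((q + 1 : ℝ) : ℂ) - 1).re = q := by simp
  have e2 : (((1 - α : ℝ) : ℂ) - 1).re = -α := by simp
  rw [norm_mul, e, Complex.norm_cpow_eq_rpow_re_of_pos hs1,
    Complex.norm_cpow_eq_rpow_re_of_pos hs2, e1, e2, mul_mul_mul_comm, mul_comm (y ^ (-α)),
    mul_assoc, mul_comm, mul_assoc]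
  have h3 : (y - s) = y * (1 - y⁻¹ * s) := by field_simp
  have h4 : s = y * (y⁻¹ * s) := by field_simp
  conv_rhs => rw [h3, h4, Real.mul_rpow hy.le (by rw [← h4]; exact hs2.le),
    Real.mul_rpow hy.le hs1.le]
  rw [← h4]
  ring

/-- The fractional integral of a power, in terms of the Beta function. -/
theorem integral_sub_rpow_mul_cpow {α y : ℝ} {P : ℂ} (hα : α < 1) (hP : -1 < P.re) (hy : 0 < y) :
    ∫ s in Ioo 0 y, (((y - s) ^ (-α) : ℝ) : ℂ) * (s : ℂ) ^ P =
      Real.Gamma (1 - α) * ((y : ℂ) ^ (P + 1 - α) *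
        (Complex.Gamma (1 + P) / Complex.Gamma (2 + P - α))) := by
  have h := Complex.betaIntegral_scaled (1 + P) ((1 - α : ℝ) : ℂ) hy
  rw [Complex.betaIntegral_eq_Gamma_mul_div _ _ (by simp; linarith) (by simp; linarith),
    intervalIntegral.integral_of_le hy.le, integral_Ioc_eq_integral_Ioo] at h
  have e1 : (1 + P) + ((1 - α : ℝ) : ℂ) = 2 + P - α := by push_cast; ring
  have e2 : (2 + P - α) - 1 = P + 1 - α := by ring
  rw [e1, e2, Complex.Gamma_ofReal] at h
  calc _ = _ := setIntegral_congr_fun measurableSet_Ioo fun s hs => ?_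
    _ = _ := h
    _ = _ := by ring
  rw [Complex.ofReal_cpow (sub_nonneg.mpr hs.2.le)]
  push_cast
  rw [mul_comm]
  ring_nf

/-- The multiplier of the fractional integral is bounded along the line of integration. -/
theorem norm_Gamma_ratio_le {α : ℝ} {P : ℂ} (hα : α < 1) (hP : -1 < P.re) :
    ‖Complex.Gamma (1 + P) / Complex.Gamma (2 + P - α)‖ ≤
      Real.Gamma (1 + P.re) / Real.Gamma (2 + P.re - α) := by
  have h := norm_Gamma_le_mul_norm_Gamma_add (z := 1 + P) (a := 1 - α) (by simp; linarith)
    (by linarith)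
  have e1 : (1 + P) + ((1 - α : ℝ) : ℂ) = 2 + P - α := by push_cast; ring
  have e2 : (1 + P).re = 1 + P.re := by simp
  rw [e1, e2, show 1 + P.re + (1 - α) = 2 + P.re - α by ring] at h
  have hpos : 0 < ‖Complex.Gamma (2 + P - α)‖ :=
    norm_pos_iff.mpr (Complex.Gamma_ne_zero_of_re_pos (by simp; linarith))
  rw [norm_div, div_le_iff₀ hpos]
  exact h

theorem continuous_Gamma_ratio_line {α p r c : ℝ} (hp : -1 < p - r * c) :
    Continuous fun v : ℝ => Complex.Gamma (1 + (p - r * (c + v * Complex.I))) /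
      Complex.Gamma (2 + (p - r * (c + v * Complex.I)) - α) := by
  simp only [div_eq_mul_inv]
  refine Continuous.mul (continuous_iff_continuousAt.mpr fun v => ?_) ?_
  · refine ContinuousAt.comp (g := Complex.Gamma)
      (f := fun v : ℝ => (1 + (p - r * (c + v * Complex.I)) : ℂ))
      (Complex.differentiableAt_Gamma _ fun m hm => ?_).continuousAt (by fun_prop)
    have := congrArg Complex.re hm
    simp at this
    linarith [(m.cast_nonneg : (0 : ℝ) ≤ m)]
  · exact Complex.differentiable_one_div_Gamma.continuous.comp
      (f := fun v : ℝ => (2 + (p - r * (c + v * Complex.I)) - α : ℂ)) (by fun_prop)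

theorem mul_Gamma_ratio {α : ℝ} {P : ℂ} :
    (P + 1 - α) * (Complex.Gamma (1 + P) / Complex.Gamma (2 + P - α)) =
      Complex.Gamma (1 + P) / Complex.Gamma (1 + P - α) := by
  by_cases h : 1 + P - α = 0
  -- At this pole of `Γ` both sides vanish by the convention `Γ(0) = 0`, `1 / 0 = 0`.
  · rw [h, show P + 1 - α = 0 by rw [← h]; ring]
    simp
  · rw [show 2 + P - α = (1 + P - α) + 1 by ring, Complex.Gamma_add_one _ h,
      show P + 1 - α = 1 + P - α by ring]
    field_simp

theorem Gamma_one_add_div_Gamma {P : ℂ} (hP : -1 < P.re) :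
    Complex.Gamma (1 + P) / Complex.Gamma P = P := by
  by_cases h : P = 0
  · simp [h]
  · have hne : Complex.Gamma P ≠ 0 := Complex.Gamma_ne_zero fun m hm => by
      rcases m with _ | m
      · simp at hm; exact h hm
      · rw [hm] at hP
        simp at hP
        linarith [(m.cast_nonneg : (0 : ℝ) ≤ m)]
    rw [add_comm, Complex.Gamma_add_one _ h, mul_div_assoc, div_self hne, mul_one]

/-- The Riemann-Liouville derivative of order `α` acts on a superposition of powers `y ^ P`,
`P = p - r η`, `Re P > -1`, by the factor `Γ(1 + P) / Γ(1 + P - α)` and the shift `P ↦ P - α`. -/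
theorem hasLeftFracDerivAt_of_mellinInv {α c p r a x : ℝ} {K : ℂ → ℂ} {φ : ℝ → ℝ}
    (hα1 : α ≤ 1) (ha : 0 < a) (hx : 0 < x) (hp : -1 < p - r * c)
    (hK : Complex.VerticalIntegrable K c)
    (hzK : Complex.VerticalIntegrable (fun z => z * K z) c)
    (hφ : ∀ s : ℝ, 0 < s → φ s = (((s ^ p : ℝ) : ℂ) * mellinInv c K (a * s ^ r)).re) :
    HasLeftFracDerivAt α φ (((x ^ (p - α) : ℝ) : ℂ) * mellinInv c (fun z => K z *
      (Complex.Gamma (1 + (p - r * z)) / Complex.Gamma (1 + (p - r * z) - α)))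
        (a * x ^ r)).re x := by
  have hre : ∀ z : ℂ, z.re = c → (p - r * z : ℂ).re = p - r * c := fun z hz => by simp [hz]
  rw [HasLeftFracDerivAt]
  split_ifs with hα
  · subst hα
    have h := hasDerivAt_rpow_mul_mellinInv (p := p) (r := r) ha hx hK hzK
    have h2 := (Complex.reCLM.hasFDerivAt.comp_hasDerivAt x h)
    have e : mellinInv c (fun z => K z * (Complex.Gamma (1 + (p - r * z)) /
        Complex.Gamma (1 + (p - r * z) - (1 : ℝ)))) =
        mellinInv c (fun z => (p - r * z) * K z) := by
      refine mellinInv_congr fun z hz => ?_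
      rw [Complex.ofReal_one, add_sub_cancel_left, Gamma_one_add_div_Gamma (by rwa [hre z hz]),
        mul_comm]
    rw [e]
    refine HasDerivAt.congr_of_eventuallyEq (f := fun s =>
      (((s ^ p : ℝ) : ℂ) * mellinInv c K (a * s ^ r)).re) h2 ?_
    filter_upwards [lt_mem_nhds hx] with s hs using hφ s hs
  · have hα' : α < 1 := lt_of_le_of_ne hα1 hα
    have hG : 0 < Real.Gamma (1 - α) := Real.Gamma_pos_of_pos (by linarith)
    set R : ℂ → ℂ := fun z => Complex.Gamma (1 + (p - r * z)) /
      Complex.Gamma (2 + (p - r * z) - α) with hR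
    have hmul : ∀ L : ℂ → ℂ, Complex.VerticalIntegrable L c →
        Complex.VerticalIntegrable (fun z => R z * L z) c := by
      intro L hL
      refine hL.bdd_mul (c := Real.Gamma (1 + (p - r * c)) / Real.Gamma (2 + (p - r * c) - α))
        (f := fun v : ℝ => R (c + v * Complex.I))
        (continuous_Gamma_ratio_line hp).aestronglyMeasurable (ae_of_all _ fun v => ?_)
      have h1 := hre (c + v * Complex.I) (by simp)
      have h2 := norm_Gamma_ratio_le (P := p - r * (c + v * Complex.I)) hα' (by rw [h1]; exact hp)
      rwa [h1] at h2
    have hRK := hmul K hK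
    have hzRK : Complex.VerticalIntegrable (fun z => z * (R z * K z)) c :=
      (hmul _ hzK).congr (ae_of_all _ fun v => by simp only; ring)
    -- The integrand of the fractional integral, as a function of `s` and the point of the line.
    have hfub : ∀ y : ℝ, 0 < y → Integrable (Function.uncurry fun s v : ℝ =>
        (((y - s) ^ (-α) : ℝ) : ℂ) * ((a : ℂ) ^ (-(c + v * Complex.I)) * K (c + v * Complex.I) *
          (s : ℂ) ^ (p - r * (c + v * Complex.I)))) ((volume.restrict (Ioo 0 y)).prod volume) := by
      intro y hy
      have hpos : ∀ᵐ w : ℝ × ℝ ∂((volume.restrict (Ioo (0 : ℝ) y)).prod volume), 0 < w.1 := by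
        refine Measure.quasiMeasurePreserving_fst.ae (p := fun s : ℝ => 0 < s) ?_
        filter_upwards [ae_restrict_mem measurableSet_Ioo] with s hs using hs.1
      have h0 := (integrableOn_sub_rpow_mul_rpow hα' hp hy).ofReal (𝕜 := ℂ)
      have h1 := (h0.mul_prod (integrable_cpow_mul ha hK)).bdd_mul (c := 1)
        (f := fun w : ℝ × ℝ => ((w.1 : ℂ) ^ (-(r * (w.2 * Complex.I))))) (by
          exact Measurable.aestronglyMeasurable (by fun_prop)) (by
          filter_upwards [hpos] with w hw
          rw [Complex.norm_cpow_eq_rpow_re_of_pos hw]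
          simp)
      refine h1.congr ?_
      filter_upwards [hpos] with w hw
      have hw0 : (w.1 : ℂ) ≠ 0 := Complex.ofReal_ne_zero.mpr hw.ne'
      have e : (w.1 : ℂ) ^ (p - r * (c + w.2 * Complex.I)) =
          (w.1 : ℂ) ^ (-(r * (w.2 * Complex.I))) * ((w.1 ^ (p - r * c) : ℝ) : ℂ) := by
        rw [Complex.ofReal_cpow hw.le, ← Complex.cpow_add _ _ hw0]
        congr 1
        push_cast
        ring
      simp only [Function.uncurry, e, RCLike.ofReal_mul, Complex.coe_algebraMap]
      ring
    have hkey : ∀ y : ℝ, 0 < y → IntegrableOn (fun s => (y - s) ^ (-α) * φ s) (Ioo 0 y) ∧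
        1 / Real.Gamma (1 - α) * ∫ s in Ioo 0 y, (y - s) ^ (-α) * φ s =
          (((y ^ (p + 1 - α) : ℝ) : ℂ) * mellinInv c (fun z => R z * K z) (a * y ^ r)).re := by
      intro y hy
      set Φ : ℝ → ℂ := fun s => (((y - s) ^ (-α) : ℝ) : ℂ) *
        (((s ^ p : ℝ) : ℂ) * mellinInv c K (a * s ^ r)) with hΦ
      have hΦeq : ∀ s ∈ Ioo 0 y, (∫ v : ℝ, (((y - s) ^ (-α) : ℝ) : ℂ) *
          ((a : ℂ) ^ (-(c + v * Complex.I)) * K (c + v * Complex.I) *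
          (s : ℂ) ^ (p - r * (c + v * Complex.I)))) * ((1 / (2 * Real.pi) : ℝ) : ℂ) = Φ s := by
        intro s hs
        rw [hΦ, integral_const_mul]
        simp only
        rw [rpow_mul_mellinInv ha hs.1]
        ring
      have hΦint : IntegrableOn Φ (Ioo 0 y) := by
        refine ((hfub y hy).integral_prod_left.mul_const
          ((1 / (2 * Real.pi) : ℝ) : ℂ)).congr ?_
        filter_upwards [ae_restrict_mem measurableSet_Ioo] with s hs
        exact hΦeq s hs
      have hφΦ : ∀ s ∈ Ioo 0 y, (Φ s).re = (y - s) ^ (-α) * φ s := by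
        intro s hs
        rw [hΦ, hφ s hs.1]
        simp only
        rw [Complex.re_ofReal_mul]
      constructor
      · exact IntegrableOn.congr_fun hΦint.re hφΦ measurableSet_Ioo
      · rw [← setIntegral_congr_fun measurableSet_Ioo hφΦ]
        have hre2 : ∫ s in Ioo 0 y, (Φ s).re = (∫ s in Ioo 0 y, Φ s).re :=
          integral_re hΦint
        have hval : ∫ s in Ioo 0 y, Φ s = Real.Gamma (1 - α) * (((y ^ (p + 1 - α) : ℝ) : ℂ) *
            mellinInv c (fun z => R z * K z) (a * y ^ r)) := by
          rw [← setIntegral_congr_fun measurableSet_Ioo hΦeq, integral_mul_const,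
            integral_integral_swap (hfub y hy), rpow_mul_mellinInv ha hy, mul_left_comm, mul_comm]
          congr 1
          rw [← integral_const_mul]
          congr 1
          funext v
          have h1 := hre (c + v * Complex.I) (by simp)
          simp only [mul_left_comm]
          rw [integral_const_mul, integral_sub_rpow_mul_cpow hα' (by rw [h1]; exact hp) hy]
          have e : (((p + 1 - α : ℝ) : ℂ) - r * (c + v * Complex.I)) =
              (p - r * (c + v * Complex.I)) + 1 - α := by push_cast; ring
          rw [e]
          simp only [hR]
          ring
        rw [hre2, hval, Complex.re_ofReal_mul]
        field_simp
    refine ⟨?_, ?_⟩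
    · filter_upwards [lt_mem_nhds hx] with y hy using (hkey y hy).1
    · have h := hasDerivAt_rpow_mul_mellinInv (p := p + 1 - α) (r := r) ha hx hRK hzRK
      have h2 := (Complex.reCLM.hasFDerivAt.comp_hasDerivAt x h)
      have e : mellinInv c (fun z => K z * (Complex.Gamma (1 + (p - r * z)) /
          Complex.Gamma (1 + (p - r * z) - α))) =
          mellinInv c (fun z => (((p + 1 - α : ℝ) : ℂ) - r * z) * (R z * K z)) := by
        refine mellinInv_congr fun z hz => ?_
        rw [← mul_Gamma_ratio]
        simp only [hR]
        push_cast
        ring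
      rw [e, show p - α = p + 1 - α - 1 by ring]
      refine HasDerivAt.congr_of_eventuallyEq (f := fun s =>
        (((s ^ (p + 1 - α) : ℝ) : ℂ) * mellinInv c (fun z => R z * K z) (a * s ^ r)).re) h2 ?_
      filter_upwards [lt_mem_nhds hx] with s hs using (hkey s hs).2

/-! ### The right fractional derivative of a Laplace-type integral -/

theorem weylKernel_of_le {α y s : ℝ} (h : s ≤ y) : weylKernel α y s = 0 := by
  simp [weylKernel, h.not_gt]

theorem measurable_weylKernel (α y : ℝ) : Measurable (weylKernel α y) :=
  Measurable.ite measurableSet_Ioi (by fun_prop) measurable_const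

theorem weylKernel_mul_exp_eq (α y l s : ℝ) : weylKernel α y s * Real.exp (-(l * s)) =
    Real.exp (-(l * y)) *
      (Ioi (0 : ℝ)).indicator (fun u => u ^ (-α) * Real.exp (-(l * u))) (s - y) := by
  by_cases h : y < s
  · have h2 : s - y ∈ Ioi (0 : ℝ) := by simpa using h
    rw [indicator_of_mem h2, weylKernel, if_pos h, mul_left_comm, ← Real.exp_add]
    ring_nf
  · have h2 : s - y ∉ Ioi (0 : ℝ) := by simpa using h
    rw [indicator_of_notMem h2, weylKernel, if_neg h]
    ring

theorem integrableOn_rpow_mul_exp_neg {α l : ℝ} (hα : α < 1) (hl : 0 < l) :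
    IntegrableOn (fun u => u ^ (-α) * Real.exp (-(l * u))) (Ioi 0) := by
  have := integrableOn_rpow_mul_exp_neg_mul_rpow (s := -α) (p := 1) (b := l) (by linarith)
    one_pos hl
  simpa using this

theorem integrable_weylKernel_mul_exp {α y l : ℝ} (hα : α < 1) (hl : 0 < l) :
    Integrable fun s => weylKernel α y s * Real.exp (-(l * s)) := by
  simp only [weylKernel_mul_exp_eq]
  exact (((integrable_indicator_iff measurableSet_Ioi).mpr
    (integrableOn_rpow_mul_exp_neg hα hl)).comp_sub_right y).const_mul _

theorem integral_weylKernel_mul_exp {α y l : ℝ} (hα : α < 1) (hl : 0 < l) (hy : 0 < y) :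
    ∫ s in Ioi (0 : ℝ), weylKernel α y s * Real.exp (-(l * s)) =
      Real.Gamma (1 - α) * l ^ (α - 1) * Real.exp (-(l * y)) := by
  rw [setIntegral_eq_integral_of_forall_compl_eq_zero]
  · simp only [weylKernel_mul_exp_eq]
    rw [integral_const_mul, integral_sub_right_eq_self
      (f := (Ioi (0 : ℝ)).indicator (fun u => u ^ (-α) * Real.exp (-(l * u)))),
      integral_indicator measurableSet_Ioi]
    have := Real.integral_rpow_mul_exp_neg_mul_Ioi (a := 1 - α) (r := l) (by linarith) hl
    rw [show 1 - α - 1 = -α by ring] at this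
    rw [this, one_div, Real.inv_rpow hl.le, ← Real.rpow_neg hl.le, neg_sub]
    ring
  · intro s hs
    rw [weylKernel_of_le, zero_mul]
    simp only [mem_Ioi, not_lt] at hs
    linarith

theorem rpow_neg_sub_rpow_neg_le {α u d : ℝ} (hα : 0 < α) (hα1 : α < 1) (hu : 0 < u) (hd : 0 ≤ d) :
    u ^ (-α) - (u + d) ^ (-α) ≤ d * u ^ (-α - 1) := by
  have hud : 0 < u + d := by linarith
  have h1 : u / (u + d) ≤ (u / (u + d)) ^ α := by
    have := Real.rpow_le_rpow_of_exponent_ge (x := u / (u + d)) (y := 1) (z := α) (by positivity)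
      ((div_le_one hud).mpr (by linarith)) hα1.le
    simpa using this
  have h2 : (u + d) ^ (-α) = u ^ (-α) * (u / (u + d)) ^ α := by
    rw [Real.div_rpow hu.le hud.le, Real.rpow_neg hu.le, Real.rpow_neg hud.le]
    field_simp
  have h3 : u ^ (-α - 1) = u ^ (-α) * u⁻¹ := by
    rw [Real.rpow_sub hu, Real.rpow_one, div_eq_mul_inv]
  have h4 : 0 < u ^ (-α) := Real.rpow_pos_of_pos hu _
  have h5 : 1 - u / (u + d) ≤ d * u⁻¹ := by
    rw [one_sub_div hud.ne', add_sub_cancel_left, div_le_iff₀ hud, mul_assoc]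
    have : u⁻¹ * (u + d) = 1 + u⁻¹ * d := by field_simp
    rw [this]
    have : 0 ≤ d * (u⁻¹ * d) := by positivity
    linarith
  rw [h2, h3]
  nlinarith

/-- The increments of the Weyl kernel are integrable, although the kernel itself is not. -/
theorem integrableOn_weylKernel_sub {α x y : ℝ} (hα : 0 < α) (hα1 : α < 1) :
    IntegrableOn (fun s => weylKernel α y s - weylKernel α x s) (Ioi 0) := by
  wlog hxy : x ≤ y generalizing x y
  · have := (this (x := y) (y := x) (le_of_not_ge hxy)).neg
    refine this.congr (ae_of_all _ fun s => ?_)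
    simp
  have hloc (z : ℝ) : IntegrableOn (weylKernel α z) (Ioc 0 (y + 1)) := by
    have h1 := (integrable_weylKernel_mul_exp (y := z) hα1 one_pos).integrableOn
      (s := Ioc 0 (y + 1))
    have h2 := Integrable.bdd_mul (c := Real.exp (y + 1)) h1
      (f := fun s => Real.exp s) (by fun_prop) (by
        filter_upwards [ae_restrict_mem measurableSet_Ioc] with s hs
        rw [Real.norm_of_nonneg (Real.exp_pos _).le]
        exact Real.exp_le_exp.mpr hs.2)
    refine h2.congr (ae_of_all _ fun s => ?_)
    simp only [one_mul]
    rw [mul_left_comm, ← Real.exp_add]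
    simp
  have hfar : IntegrableOn (fun s => weylKernel α y s - weylKernel α x s) (Ioi (y + 1)) := by
    have h1 := (integrableOn_add_rpow_Ioi_of_lt (a := -α - 1) (c := y + 1) (m := -y)
      (by linarith) (by linarith)).const_mul (y - x)
    refine Integrable.mono' h1
      ((measurable_weylKernel α y).sub (measurable_weylKernel α x)).aestronglyMeasurable ?_
    filter_upwards [ae_restrict_mem measurableSet_Ioi] with s hs
    have hs' : y + 1 < s := hs
    have h2 : 0 < s - y := by linarith
    rw [weylKernel, weylKernel, if_pos (by linarith), if_pos (by linarith)]
    have h3 := rpow_neg_sub_rpow_neg_le hα hα1 h2 (d := y - x) (by linarith)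
    rw [show s - y + (y - x) = s - x by ring] at h3
    rw [Real.norm_of_nonneg]
    · simpa [sub_eq_add_neg] using h3
    · rw [sub_nonneg]
      exact Real.rpow_le_rpow_of_nonpos h2 (by linarith) (by linarith)
  by_cases hy : 0 ≤ y + 1
  · rw [← Ioc_union_Ioi_eq_Ioi hy]
    exact ((hloc y).sub (hloc x)).union hfar
  · exact hfar.mono_set (Ioi_subset_Ioi (by linarith))

theorem rpow_mul_exp_neg_le {α m t : ℝ} (hα : 0 < α) (hα1 : α < 1) (hm : 0 < m) (ht : 0 < t) :
    t ^ α * Real.exp (-(m * t)) ≤ 1 + 1 / m := by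
  have h1 : t ^ α ≤ 1 + t := by
    rcases le_total t 1 with h | h
    · have := Real.rpow_le_one ht.le h hα.le; linarith
    · have := Real.rpow_le_rpow_of_exponent_le h hα1.le
      rw [Real.rpow_one] at this; linarith
  have h2 : Real.exp (-(m * t)) ≤ 1 := Real.exp_le_one_iff.mpr (by nlinarith)
  have h3 : t * Real.exp (-(m * t)) ≤ 1 / m := by
    have := Real.add_one_le_exp (m * t)
    rw [Real.exp_neg, ← div_eq_mul_inv, div_le_div_iff₀ (Real.exp_pos _) hm]
    nlinarith
  have h4 : 0 < Real.exp (-(m * t)) := Real.exp_pos _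
  nlinarith

/-- The right derivative of order `ν` multiplies `e^{-s / σ}` by `σ^{-ν}`. No decay of `r`
at infinity is needed to differentiate under the integral sign: the increments of the Weyl kernel
between `x` and `y` are integrable and vanish for `s ≤ m = min x y`, so that `e^{-s / σ}` may be
bounded by `e^{-m / σ}`. -/
theorem hasRightFracDerivAt_of_laplace {ν x : ℝ} {φ r : ℝ → ℝ} (hν : 0 < ν) (hν1 : ν < 1)
    (hx : 0 < x) (hr : AEStronglyMeasurable r (volume.restrict (Ioi 0)))
    (hint : ∀ s, 0 < s → IntegrableOn (fun σ => Real.exp (-(s / σ)) * r σ) (Ioi 0))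
    (hφ : ∀ s, 0 < s → φ s = ∫ σ in Ioi (0 : ℝ), Real.exp (-(s / σ)) * r σ) :
    HasRightFracDerivAt ν φ (∫ σ in Ioi (0 : ℝ), σ ^ (-ν) * (Real.exp (-(x / σ)) * r σ)) x := by
  have hG : 0 < Real.Gamma (1 - ν) := Real.Gamma_pos_of_pos (by linarith)
  have hfub : ∀ y, 0 < y → Integrable (Function.uncurry fun s σ : ℝ =>
      (weylKernel ν y s - weylKernel ν x s) * (Real.exp (-(s / σ)) * r σ))
      ((volume.restrict (Ioi 0)).prod (volume.restrict (Ioi 0))) := by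
    intro y hy
    set m := min x y with hm
    have hm0 : 0 < m := lt_min hx hy
    have h0 := (integrableOn_weylKernel_sub (x := x) (y := y) hν hν1).mul_prod (hint m hm0)
    have hpos : ∀ᵐ w : ℝ × ℝ ∂((volume.restrict (Ioi (0 : ℝ))).prod
        (volume.restrict (Ioi (0 : ℝ)))), 0 < w.2 :=
      Measure.quasiMeasurePreserving_snd.ae (p := fun s : ℝ => 0 < s)
        (ae_restrict_mem measurableSet_Ioi)
    refine h0.norm.mono' ?_ ?_
    · refine AEStronglyMeasurable.mul (Measurable.aestronglyMeasurable ?_)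
        (AEStronglyMeasurable.mul (Measurable.aestronglyMeasurable ?_) ?_)
      · exact ((measurable_weylKernel ν y).comp measurable_fst).sub
          ((measurable_weylKernel ν x).comp measurable_fst)
      · fun_prop
      · exact hr.comp_quasiMeasurePreserving Measure.quasiMeasurePreserving_snd
    · filter_upwards [hpos] with w hw
      simp only [Function.uncurry]
      rcases le_total w.1 m with h | h
      · rw [weylKernel_of_le (h.trans (min_le_right _ _)),
          weylKernel_of_le (h.trans (min_le_left _ _))]
        simp
      · rw [norm_mul, norm_mul, norm_mul, norm_mul, Real.norm_of_nonneg (Real.exp_pos _).le,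
          Real.norm_of_nonneg (Real.exp_pos _).le]
        gcongr
  have hinner : ∀ y, 0 < y → ∀ σ, 0 < σ →
      ∫ s in Ioi (0 : ℝ), (weylKernel ν y s - weylKernel ν x s) * (Real.exp (-(s / σ)) * r σ) =
        Real.Gamma (1 - ν) *
          (σ ^ (1 - ν) * (Real.exp (-(y / σ)) - Real.exp (-(x / σ))) * r σ) := by
    intro y hy σ hσ
    have hl : 0 < σ⁻¹ := inv_pos.mpr hσ
    have e : ∀ s : ℝ, s / σ = σ⁻¹ * s := fun s => by rw [div_eq_mul_inv, mul_comm]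
    have h1 : ∀ s : ℝ, (weylKernel ν y s - weylKernel ν x s) * (Real.exp (-(s / σ)) * r σ) =
        (weylKernel ν y s * Real.exp (-(σ⁻¹ * s)) - weylKernel ν x s * Real.exp (-(σ⁻¹ * s))) *
          r σ := fun s => by rw [e]; ring
    simp only [h1]
    rw [integral_mul_const, integral_sub
      (integrable_weylKernel_mul_exp hν1 hl).integrableOn
      (integrable_weylKernel_mul_exp hν1 hl).integrableOn,
      integral_weylKernel_mul_exp hν1 hl hy, integral_weylKernel_mul_exp hν1 hl hx,
      e, e, Real.inv_rpow hσ.le, ← Real.rpow_neg hσ.le, neg_sub]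
    ring
  have hval : ∀ y, 0 < y →
      IntegrableOn (fun s => (weylKernel ν y s - weylKernel ν x s) * φ s) (Ioi 0) ∧
      ∫ s in Ioi (0 : ℝ), (weylKernel ν y s - weylKernel ν x s) * φ s = Real.Gamma (1 - ν) *
        ∫ σ in Ioi (0 : ℝ), σ ^ (1 - ν) * (Real.exp (-(y / σ)) - Real.exp (-(x / σ))) * r σ := by
    intro y hy
    have h1 : ∀ s ∈ Ioi (0 : ℝ), ∫ σ in Ioi (0 : ℝ), (weylKernel ν y s - weylKernel ν x s) *
        (Real.exp (-(s / σ)) * r σ) = (weylKernel ν y s - weylKernel ν x s) * φ s := by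
      intro s hs
      rw [integral_const_mul, hφ s hs]
    constructor
    · exact IntegrableOn.congr_fun (hfub y hy).integral_prod_left h1 measurableSet_Ioi
    · rw [← setIntegral_congr_fun measurableSet_Ioi h1, integral_integral_swap (hfub y hy),
        ← integral_const_mul]
      exact setIntegral_congr_fun measurableSet_Ioi fun σ hσ => hinner y hy σ hσ
  rw [HasRightFracDerivAt, if_neg hν1.ne]
  refine ⟨?_, ?_⟩
  · filter_upwards [lt_mem_nhds hx] with y hy using (hval y hy).1
  have hx2 : 0 < x / 2 := half_pos hx
  have hx4 : 0 < x / 4 := by linarith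
  have key := (hasDerivAt_integral_of_dominated_loc_of_deriv_le
    (μ := volume.restrict (Ioi (0 : ℝ)))
    (F := fun y σ => -(σ ^ (1 - ν) * (Real.exp (-(y / σ)) - Real.exp (-(x / σ))) * r σ))
    (F' := fun y σ => σ ^ (-ν) * (Real.exp (-(y / σ)) * r σ))
    (bound := fun σ => (1 + 1 / (x / 4)) * ‖Real.exp (-((x / 4) / σ)) * r σ‖)
    (x₀ := x) (s := Ioi (x / 2)) (Ioi_mem_nhds (by linarith)) ?_ ?_ ?_ ?_ ?_ ?_).2
  · refine key.congr_of_eventuallyEq ?_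
    filter_upwards [lt_mem_nhds hx] with y hy
    rw [(hval y hy).2, integral_neg]
    field_simp
  · refine Eventually.of_forall fun y => ?_
    exact ((Measurable.aestronglyMeasurable (by fun_prop)).mul hr).neg
  · simp
  · exact (Measurable.aestronglyMeasurable (by fun_prop)).mul
      ((Measurable.aestronglyMeasurable (by fun_prop)).mul hr)
  · filter_upwards [ae_restrict_mem measurableSet_Ioi] with σ hσ y hy
    have hσ' : 0 < σ := hσ
    have hy' : x / 2 < y := hy
    have h1 := rpow_mul_exp_neg_le hν hν1 hx4 (inv_pos.mpr hσ')
    rw [Real.inv_rpow hσ'.le, ← Real.rpow_neg hσ'.le, ← div_eq_mul_inv] at h1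
    have h2 : Real.exp (-(y / σ)) ≤ Real.exp (-(x / 4 / σ)) * Real.exp (-(x / 4 / σ)) := by
      rw [← Real.exp_add, Real.exp_le_exp, ← neg_add, neg_le_neg_iff, ← add_div]
      gcongr
      linarith
    rw [norm_mul, norm_mul, norm_mul, Real.norm_of_nonneg (Real.exp_pos _).le,
      Real.norm_of_nonneg (Real.exp_pos _).le, Real.norm_of_nonneg (Real.rpow_nonneg hσ'.le _)]
    calc _ ≤ σ ^ (-ν) * ((Real.exp (-(x / 4 / σ)) * Real.exp (-(x / 4 / σ))) * ‖r σ‖) := by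
          gcongr
      _ = (σ ^ (-ν) * Real.exp (-(x / 4 / σ))) * (Real.exp (-(x / 4 / σ)) * ‖r σ‖) := by ring
      _ ≤ _ := by gcongr
  · exact (hint _ hx4).norm.const_mul _
  · filter_upwards [ae_restrict_mem measurableSet_Ioi] with σ hσ y hy
    have hσ' : 0 < σ := hσ
    have h1 : HasDerivAt (fun y : ℝ => Real.exp (-(y / σ))) (Real.exp (-(y / σ)) * (-(1 / σ))) y :=
      (((hasDerivAt_id y).div_const σ).neg).exp
    have h2 := ((h1.sub_const (Real.exp (-(x / σ)))).const_mul (σ ^ (1 - ν))).mul_const (r σ)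
    refine h2.neg.congr_deriv ?_
    have h3 : σ ^ (1 - ν) = σ * σ ^ (-ν) := by
      rw [sub_eq_add_neg, Real.rpow_add hσ', Real.rpow_one]
    rw [h3]
    field_simp

/-! ### Kernels of the densities -/

/-- The Mellin transform `Γ(1 - z/ν) / Γ(1 - z)` of `x h_ν(x, 1)`. -/
noncomputable def stableKernel (ν : ℝ) (z : ℂ) : ℂ :=
  Complex.Gamma (1 - z / ν) / Complex.Gamma (1 - z)

/-- The Mellin transform `Γ(1 + z) / Γ(1 + β z)` of `x l_β(x, 1)`. -/
noncomputable def inverseStableKernel (β : ℝ) (z : ℂ) : ℂ :=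
  Complex.Gamma (1 + z) / Complex.Gamma (1 + β * z)

/-- The Mellin transform of `x 𝔣_{ν,β}(x, 1)`. -/
noncomputable def mixedKernel (ν β : ℝ) (z : ℂ) : ℂ :=
  stableKernel ν z * inverseStableKernel β (z / ν)

/-- The Mellin transform of `x 𝐠^{ν,β}_μ(x, 1)`. -/
noncomputable def densityKernel (μ ν β : ℝ) (z : ℂ) : ℂ :=
  (Real.Gamma μ : ℂ)⁻¹ * (mixedKernel ν β z * Complex.Gamma (μ + z))

theorem stableKernel_conj (ν : ℝ) (z : ℂ) :
    stableKernel ν ((starRingEnd ℂ) z) = (starRingEnd ℂ) (stableKernel ν z) := by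
  simp [stableKernel, ← Complex.Gamma_conj]

theorem inverseStableKernel_conj (β : ℝ) (z : ℂ) :
    inverseStableKernel β ((starRingEnd ℂ) z) = (starRingEnd ℂ) (inverseStableKernel β z) := by
  simp [inverseStableKernel, ← Complex.Gamma_conj]

theorem stableKernel_one {z : ℂ} (hz : z.re < 1) : stableKernel 1 z = 1 := by
  rw [stableKernel, Complex.ofReal_one, div_one, div_self]
  exact Complex.Gamma_ne_zero_of_re_pos (by simpa using hz)

theorem inverseStableKernel_one {z : ℂ} (hz : -1 < z.re) : inverseStableKernel 1 z = 1 := by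
  rw [inverseStableKernel, Complex.ofReal_one, one_mul, div_self]
  exact Complex.Gamma_ne_zero_of_re_pos (by simp; linarith)

theorem stripGrowth_stableKernel {ν : ℝ} (hν : 0 < ν) (hν1 : ν ≤ 1) :
    StripGrowth (stableKernel ν) (Real.pi / 2 * (1 / ν - 1)) (-1) ν := by
  have hi : 0 < 1 / ν := by positivity
  have h1 := stripGrowth_Gamma (p := 1) (q := -(1 / ν)) (a := -1) (b := ν)
    (by linarith) (by field_simp; simp) (Or.inl (by linarith))
  have h2 := stripGrowth_inv_Gamma (p := 1) (q := -1) (a := -1) (b := ν)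
    (by norm_num) (by linarith) (Or.inl (by norm_num))
  have h := h1.mul h2
  rw [abs_neg, abs_of_pos hi, abs_neg, abs_one,
    show Real.pi / 2 * (1 / ν) + -(Real.pi / 2 * 1) = Real.pi / 2 * (1 / ν - 1) by ring] at h
  refine h.congr fun z _ _ => ?_
  rw [stableKernel, div_eq_mul_inv]
  push_cast
  congr 2
  · ring
  · congr 1; ring

theorem stripGrowth_inverseStableKernel {ν β : ℝ} (hν : 0 < ν) (hβ : 0 < β) (hβ1 : β ≤ 1) :
    StripGrowth (fun z => inverseStableKernel β (z / ν)) (Real.pi / 2 * ((1 - β) / ν)) (-ν) ν := by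
  have hi : 0 < 1 / ν := by positivity
  have hb : 0 < β / ν := by positivity
  have e1 : 1 / ν * ν = 1 := by field_simp
  have e2 : β / ν * ν = β := by field_simp
  have h1 := stripGrowth_Gamma (p := 1) (q := 1 / ν) (a := -ν) (b := ν)
    (by linarith) (by linarith) (Or.inr (by linarith))
  have h2 := stripGrowth_inv_Gamma (p := 1) (q := β / ν) (a := -ν) (b := ν)
    (by linarith) (by linarith) (Or.inr (by linarith))
  have h := h1.mul h2
  rw [abs_of_pos hi, abs_of_pos hb, show Real.pi / 2 * (1 / ν) + -(Real.pi / 2 * (β / ν)) =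
    Real.pi / 2 * ((1 - β) / ν) by ring] at h
  refine h.congr fun z _ _ => ?_
  rw [inverseStableKernel, div_eq_mul_inv]
  push_cast
  congr 2
  · congr 1; ring
  · congr 1; ring

theorem stripGrowth_mixedKernel {ν β : ℝ} (hν : 0 < ν) (hν1 : ν ≤ 1) (hβ : 0 < β) (hβ1 : β ≤ 1) :
    StripGrowth (mixedKernel ν β) (Real.pi / 2 * (1 / ν - 1) + Real.pi / 2 * ((1 - β) / ν))
      (-ν) ν :=
  ((stripGrowth_stableKernel hν hν1).mono (by linarith) le_rfl).mul
    (stripGrowth_inverseStableKernel hν hβ hβ1)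

theorem mixedKernel_rate_nonneg {ν β : ℝ} (hν : 0 < ν) (hν1 : ν ≤ 1) (hβ1 : β ≤ 1) :
    0 ≤ Real.pi / 2 * (1 / ν - 1) + Real.pi / 2 * ((1 - β) / ν) := by
  have h1 : 0 ≤ 1 / ν - 1 := by rw [sub_nonneg, le_div_iff₀ hν]; linarith
  have h2 : 0 ≤ (1 - β) / ν := div_nonneg (by linarith) hν.le
  positivity

theorem mixedKernel_rate_pos {ν β : ℝ} (hν : 0 < ν) (hν1 : ν ≤ 1) (hβ1 : β ≤ 1)
    (h : ¬(ν = 1 ∧ β = 1)) :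
    0 < Real.pi / 2 * (1 / ν - 1) + Real.pi / 2 * ((1 - β) / ν) := by
  refine lt_of_le_of_ne (mixedKernel_rate_nonneg hν hν1 hβ1) fun h0 => h ?_
  have h1 : 0 ≤ 1 / ν - 1 := by rw [sub_nonneg, le_div_iff₀ hν]; linarith
  have h2 : 0 ≤ (1 - β) / ν := div_nonneg (by linarith) hν.le
  have hpi := Real.pi_pos
  have h3 : 1 / ν - 1 + (1 - β) / ν = 0 := by
    have : Real.pi / 2 * (1 / ν - 1 + (1 - β) / ν) = 0 := by linarith
    exact (mul_eq_zero.mp this).resolve_left (by positivity)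
  have h4 : 1 / ν - 1 = 0 := by linarith
  have h5 : (1 - β) / ν = 0 := by linarith
  constructor
  · field_simp at h4; linarith
  · rcases div_eq_zero_iff.mp h5 with h6 | h6 <;> linarith

theorem stripGrowth_mixedKernel_mul_Gamma {m ν β d : ℝ} (hν : 0 < ν) (hν1 : ν ≤ 1) (hβ : 0 < β)
    (hβ1 : β ≤ 1) (hd : d ≤ ν) (hd0 : 0 < d) (hdm : d ≤ m) :
    StripGrowth (fun z => mixedKernel ν β z * Complex.Gamma (m + z))
      (Real.pi / 2 * (1 / ν - 1) + Real.pi / 2 * ((1 - β) / ν) + Real.pi / 2) (-d) ν := by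
  have h2 := stripGrowth_Gamma (p := m) (q := 1) (a := -d) (b := ν)
    (by linarith) (by linarith) (Or.inr (by linarith))
  have h := ((stripGrowth_mixedKernel hν hν1 hβ hβ1).mono (neg_le_neg hd) le_rfl).mul h2
  rw [abs_one, mul_one] at h
  exact h.congr fun z _ _ => by simp

theorem stripGrowth_densityKernel {μ ν β : ℝ} (hμ : 0 < μ) (hν : 0 < ν) (hν1 : ν ≤ 1) (hβ : 0 < β)
    (hβ1 : β ≤ 1) :
    StripGrowth (densityKernel μ ν β)
      (Real.pi / 2 * (1 / ν - 1) + Real.pi / 2 * ((1 - β) / ν) + Real.pi / 2) (-min μ ν) ν := by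
  have h := (stripGrowth_const (Real.Gamma μ : ℂ)⁻¹ (-min μ ν) ν).mul
    (stripGrowth_mixedKernel_mul_Gamma (m := μ) hν hν1 hβ hβ1 (min_le_right μ ν) (lt_min hμ hν)
      (min_le_left μ ν))
  rw [zero_add] at h
  exact h

theorem densityKernel_rate_pos {ν β : ℝ} (hν : 0 < ν) (hν1 : ν ≤ 1) (hβ1 : β ≤ 1) :
    0 < Real.pi / 2 * (1 / ν - 1) + Real.pi / 2 * ((1 - β) / ν) + Real.pi / 2 := by
  have := mixedKernel_rate_nonneg hν hν1 hβ1
  have := Real.pi_pos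
  linarith

/-! ### Mellin-Barnes representations of the densities -/

theorem mellinInv_cpow_mul {c x y : ℝ} (K : ℂ → ℂ) (hx : 0 < x) (hy : 0 < y) :
    mellinInv c (fun z => (y : ℂ) ^ (-z) * K z) x = mellinInv c K (y * x) := by
  rw [mellinInv_eq, mellinInv_eq]
  congr 2
  funext v
  rw [Complex.ofReal_mul, Complex.mul_cpow_ofReal_nonneg hy.le hx.le]
  ring

theorem one_div_rpow_mul_inv_div {x t q : ℝ} (hx : 0 < x) (ht : 0 < t) :
    1 / t ^ q * (x / t ^ q) ^ (-(1 : ℝ)) = x⁻¹ := by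
  have := Real.rpow_pos_of_pos ht q
  rw [Real.rpow_neg_one]
  field_simp

/-- The defining integral on the line `Re η = 1/2`, after the substitution `η = z + 1`. -/
theorem stableDensity_eq {ν : ℝ} (hν : 0 < ν) (hν1 : ν < 1) {c : ℝ} (hc : c ∈ Ioo (-1) ν)
    {x t : ℝ} (hx : 0 < x) (ht : 0 < t) :
    (stableDensity ν x t : ℂ) =
      (x : ℂ)⁻¹ * mellinInv c (stableKernel ν) (x * t ^ (-(1 / ν))) := by
  have hκ : 0 < Real.pi / 2 * (1 / ν - 1) := by
    have : 0 < 1 / ν - 1 := by rw [sub_pos, lt_div_iff₀ hν]; linarith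
    have := Real.pi_pos
    positivity
  have htp := Real.rpow_pos_of_pos ht (1 / ν)
  have hz : 0 < x / t ^ (1 / ν) := div_pos hx htp
  have hshift : foxH (1 / 2) 0 1 ![(1 - 1 / ν, 1 / ν)] ![(0, 1)] (x / t ^ (1 / ν)) =
      (((x / t ^ (1 / ν)) ^ (-(1 : ℝ)) : ℝ) : ℂ) *
        (ν * mellinInv c (stableKernel ν) (x / t ^ (1 / ν))) := by
    rw [foxH, show (1 / 2 : ℝ) = -(1 / 2) + 1 by norm_num, mellinInv_add hz,
      (stripGrowth_stableKernel hν hν1.le).mellinInv_eq_mellinInv hκ hc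
        (c' := -(1 / 2)) ⟨by norm_num, by linarith⟩ hz,
      ← mellinInv_const_mul _ (ν : ℂ) (stableKernel ν)]
    refine congrArg _ (congrFun (mellinInv_congr fun z hz => ?_) _)
    have hz0 : z ≠ 0 := by rintro rfl; norm_num at hz
    have hν0 : (ν : ℂ) ≠ 0 := Complex.ofReal_ne_zero.mpr hν.ne'
    have e1 : Complex.Gamma (1 - z / ν) = -z / ν * Complex.Gamma (-z / ν) := by
      rw [← Complex.Gamma_add_one _ (div_ne_zero (neg_ne_zero.mpr hz0) hν0)]
      congr 1; ring
    have e2 : Complex.Gamma (1 - z) = -z * Complex.Gamma (-z) := by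
      rw [← Complex.Gamma_add_one _ (neg_ne_zero.mpr hz0)]
      congr 1; ring
    have e3 : (1 : ℂ) / ν - (z + 1) * (1 / ν) = -z / ν := by ring
    simp only [foxKernel, Finset.prod_filter, Fin.prod_univ_succ]
    simp only [stableKernel, e1, e2]
    simp [-one_div]
    rw [e3]
    field_simp
  have hreal := ofReal_re_mellinInv (c := c) (stableKernel_conj ν) hz
  rw [stableDensity, hshift, Complex.re_ofReal_mul, Complex.re_ofReal_mul]
  push_cast
  rw [hreal, Real.rpow_neg ht.le (1 / ν), ← div_eq_mul_inv]
  have h1 := one_div_rpow_mul_inv_div (q := 1 / ν) hx ht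
  have hν0 : (ν : ℂ) ≠ 0 := Complex.ofReal_ne_zero.mpr hν.ne'
  calc _ = ((1 / t ^ (1 / ν) * (x / t ^ (1 / ν)) ^ (-(1 : ℝ)) : ℝ) : ℂ) *
        mellinInv c (stableKernel ν) (x / t ^ (1 / ν)) := by
        push_cast
        field_simp
    _ = _ := by rw [h1]; push_cast; rfl

theorem inverseStableDensity_eq {β : ℝ} (hβ : 0 < β) (hβ1 : β < 1) {c : ℝ}
    (hc : c ∈ Ioo (-1 : ℝ) 1) {x t : ℝ} (hx : 0 < x) (ht : 0 < t) :
    (inverseStableDensity β x t : ℂ) =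
      (x : ℂ)⁻¹ * mellinInv c (inverseStableKernel β) (x * t ^ (-β)) := by
  have hstrip := stripGrowth_inverseStableKernel one_pos hβ hβ1.le
  simp only [Complex.ofReal_one, div_one] at hstrip
  have hκ : 0 < Real.pi / 2 * (1 - β) := by
    have : 0 < 1 - β := by linarith
    have := Real.pi_pos
    positivity
  have htp := Real.rpow_pos_of_pos ht β
  have hz : 0 < x / t ^ β := div_pos hx htp
  have hshift : foxH (1 / 2) 1 0 ![(1 - β, β)] ![(0, 1)] (x / t ^ β) =
      (((x / t ^ β) ^ (-(1 : ℝ)) : ℝ) : ℂ) *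
        mellinInv c (inverseStableKernel β) (x / t ^ β) := by
    rw [foxH, show (1 / 2 : ℝ) = -(1 / 2) + 1 by norm_num, mellinInv_add hz,
      hstrip.mellinInv_eq_mellinInv hκ hc (c' := -(1 / 2)) ⟨by norm_num, by norm_num⟩ hz]
    refine congrArg _ (congrFun (mellinInv_congr fun z hz => ?_) _)
    simp only [foxKernel, Finset.prod_filter, Fin.prod_univ_succ]
    simp only [inverseStableKernel]
    simp
    congr 2 <;> ring
  have hreal := ofReal_re_mellinInv (c := c) (inverseStableKernel_conj β) hz
  rw [inverseStableDensity, hshift, Complex.re_ofReal_mul]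
  push_cast
  rw [hreal, Real.rpow_neg ht.le β, ← div_eq_mul_inv]
  have h1 := one_div_rpow_mul_inv_div (q := β) hx ht
  calc _ = ((1 / t ^ β * (x / t ^ β) ^ (-(1 : ℝ)) : ℝ) : ℂ) *
        mellinInv c (inverseStableKernel β) (x / t ^ β) := by
        push_cast
        field_simp
    _ = _ := by rw [h1]; push_cast; rfl

theorem mixedDensity_convolution {ν β : ℝ} (hν : 0 < ν) (hν1 : ν < 1) (hβ : 0 < β) (hβ1 : β < 1)
    {c : ℝ} (hc : c ∈ Ioo (-ν) ν) {x t : ℝ} (hx : 0 < x) (ht : 0 < t) :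
    IntegrableOn (fun s => stableDensity ν x s * inverseStableDensity β s t) (Ioi 0) ∧
      ((∫ s in Ioi (0 : ℝ), stableDensity ν x s * inverseStableDensity β s t : ℝ) : ℂ) =
        (x : ℂ)⁻¹ * mellinInv c (mixedKernel ν β) (x * t ^ (-(β / ν))) := by
  have hstrip := stripGrowth_inverseStableKernel one_pos hβ hβ1.le
  simp only [Complex.ofReal_one, div_one] at hstrip
  have hκ : 0 < Real.pi / 2 * (1 - β) := by
    have : 0 < 1 - β := by linarith
    have := Real.pi_pos
    positivity
  have hκ' : 0 < Real.pi / 2 * (1 / ν - 1) := by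
    have : 0 < 1 / ν - 1 := by rw [sub_pos, lt_div_iff₀ hν]; linarith
    have := Real.pi_pos
    positivity
  have hc' : c ∈ Ioo (-1) ν := ⟨by linarith [hc.1], hc.2⟩
  have hcν : 1 / ν * c ∈ Ioo (-1 : ℝ) 1 := by
    constructor
    · rw [one_div, ← div_eq_inv_mul, lt_div_iff₀ hν]; linarith [hc.1]
    · rw [one_div, ← div_eq_inv_mul, div_lt_one hν]; exact hc.2
  have htp : 0 < t ^ (-β) := Real.rpow_pos_of_pos ht _
  have hmem (z : ℂ) (hz : z.re = c) : ((1 / ν : ℝ) * z : ℂ).re ∈ Ioo (-1 : ℝ) 1 := by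
    rw [Complex.re_ofReal_mul, hz]; exact hcν
  set φ : ℝ → ℂ := fun s => mellinInv 0 (inverseStableKernel β) (t ^ (-β) * s) with hφ
  have h0 : (0 : ℝ) ∈ Ioo (-1 : ℝ) 1 := ⟨by norm_num, by norm_num⟩
  have hφc : MellinConvergent φ ((1 / ν * c : ℝ) : ℂ) := by
    refine (MellinConvergent.comp_mul_left htp).mpr ?_
    exact hstrip.mellinConvergent_mellinInv hκ h0 (by simpa using hcν)
  have hconv := mellinInv_convolution hx
    ((stripGrowth_stableKernel hν hν1.le).verticalIntegrable hκ' hc') hφc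
  have heq : ∀ s ∈ Ioi (0 : ℝ), mellinInv c (stableKernel ν) (x * s ^ (-(1 / ν))) * φ s *
      (s : ℂ)⁻¹ = x * ((stableDensity ν x s * inverseStableDensity β s t : ℝ) : ℂ) := by
    intro s hs
    have hx0 : (x : ℂ) ≠ 0 := Complex.ofReal_ne_zero.mpr hx.ne'
    rw [Complex.ofReal_mul, stableDensity_eq hν hν1 hc' hx hs,
      inverseStableDensity_eq hβ hβ1 h0 hs ht, hφ, mul_comm s]
    field_simp
  have hx0 : (x : ℂ) ≠ 0 := Complex.ofReal_ne_zero.mpr hx.ne'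
  constructor
  · have h1 := (IntegrableOn.congr_fun hconv.1 heq measurableSet_Ioi).const_mul (x : ℂ)⁻¹
    refine h1.re.congr (ae_of_all _ fun s => ?_)
    simp only [← mul_assoc, inv_mul_cancel₀ hx0, one_mul]
    exact Complex.ofReal_re _
  · have h1 := hconv.2
    rw [setIntegral_congr_fun measurableSet_Ioi heq, integral_const_mul, integral_complex_ofReal] at h1
    rw [eq_inv_mul_iff_mul_eq₀ hx0]
    refine h1.trans ?_
    have htq : 0 < t ^ (-(β / ν)) := Real.rpow_pos_of_pos ht _
    rw [mul_comm x, ← mellinInv_cpow_mul _ hx htq]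
    refine congrFun (mellinInv_congr fun z hz => ?_) x
    rw [hφ, mellin_comp_mul_left _ _ htp,
      hstrip.mellin_mellinInv hκ h0 (hmem z hz), smul_eq_mul, mixedKernel]
    have e1 : ((1 / ν : ℝ) : ℂ) * z = z / ν := by push_cast; ring
    have e2 : ((t ^ (-β) : ℝ) : ℂ) ^ (-(z / ν)) = ((t ^ (-(β / ν)) : ℝ) : ℂ) ^ (-z) := by
      rw [← Complex.cpow_mul_ofReal_nonneg ht.le, ← Complex.cpow_mul_ofReal_nonneg ht.le]
      congr 1
      push_cast
      ring
    rw [e1, e2]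
    ring

theorem mixedDensity_eq {ν β : ℝ} (hν : 0 < ν) (hν1 : ν ≤ 1) (hβ : 0 < β) (hβ1 : β ≤ 1)
    (h11 : ¬(ν = 1 ∧ β = 1)) {c : ℝ} (hc : c ∈ Ioo (-ν) ν) {x t : ℝ} (hx : 0 < x) (ht : 0 < t) :
    (mixedDensity ν β x t : ℂ) =
      (x : ℂ)⁻¹ * mellinInv c (mixedKernel ν β) (x * t ^ (-(β / ν))) := by
  rw [mixedDensity]
  split_ifs with h1 h2
  · subst h1
    have hν' : ν < 1 := lt_of_le_of_ne hν1 fun h => h11 ⟨h, rfl⟩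
    rw [stableDensity_eq hν hν' ⟨by linarith [hc.1], hc.2⟩ hx ht]
    refine congrArg _ (congrFun (mellinInv_congr fun z hz => ?_) _)
    rw [mixedKernel, inverseStableKernel_one, mul_one]
    rw [Complex.div_ofReal_re, hz, lt_div_iff₀ hν]
    linarith [hc.1]
  · subst h2
    rw [inverseStableDensity_eq hβ (lt_of_le_of_ne hβ1 h1) hc hx ht, div_one]
    refine congrArg _ (congrFun (mellinInv_congr fun z hz => ?_) _)
    rw [mixedKernel, stableKernel_one (by rw [hz]; exact hc.2), one_mul, Complex.ofReal_one,
      div_one]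
  · exact (mixedDensity_convolution hν (lt_of_le_of_ne hν1 h2) hβ (lt_of_le_of_ne hβ1 h1)
      hc hx ht).2

theorem mellin_rpow_mul_exp_neg_div {m y : ℝ} {z : ℂ} (hy : 0 < y) (hz : 0 < m + z.re) :
    MellinConvergent (fun s : ℝ => ((s ^ (-m) * Real.exp (-(y / s)) : ℝ) : ℂ)) (-z) ∧
      mellin (fun s : ℝ => ((s ^ (-m) * Real.exp (-(y / s)) : ℝ) : ℂ)) (-z) =
        ((y ^ (-m) : ℝ) : ℂ) * ((y : ℂ) ^ (-z) * Complex.Gamma (m + z)) := by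
  have hy0 : (y : ℂ) ≠ 0 := Complex.ofReal_ne_zero.mpr hy.ne'
  set E : ℝ → ℂ := fun v => ((Real.exp (-v) : ℝ) : ℂ) with hE
  set ψ : ℝ → ℂ := fun v => (v : ℂ) ^ (m : ℂ) • E (y * v) with hψ
  have hre : 0 < (z + m : ℂ).re := by simp; linarith
  have hE1 : MellinConvergent E (z + m) :=
    (Complex.GammaIntegral_convergent hre).congr (ae_of_all _ fun v => by
      simp only [hE, smul_eq_mul, mul_comm, Complex.ofReal_neg, Complex.ofReal_exp])
  have hE2 : mellin E (z + m) = Complex.Gamma (z + m) := by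
    rw [Complex.Gamma_eq_integral hre, Complex.GammaIntegral_eq_mellin]
  have hψ1 : MellinConvergent ψ z :=
    MellinConvergent.cpow_smul.mpr ((MellinConvergent.comp_mul_left hy).mpr hE1)
  have hψ2 : mellin ψ z = (y : ℂ) ^ (-(z + m)) * Complex.Gamma (z + m) := by
    rw [hψ, mellin_cpow_smul, mellin_comp_mul_left _ _ hy, hE2, smul_eq_mul]
  have heq : ∀ s ∈ Ioi (0 : ℝ), ψ (s ^ (-1 : ℝ)) =
      ((s ^ (-m) * Real.exp (-(y / s)) : ℝ) : ℂ) := by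
    intro s hs
    have hs0 : (0 : ℝ) < s := hs
    rw [hψ, hE, Real.rpow_neg_one]
    simp only
    rw [← Complex.ofReal_cpow (inv_pos.mpr hs0).le, Real.inv_rpow hs0.le, ← Real.rpow_neg hs0.le,
      smul_eq_mul, ← Complex.ofReal_mul, div_eq_mul_inv]
  constructor
  · have h1 := (MellinConvergent.comp_rpow (f := ψ) (s := -z) (a := -1) (by norm_num)).mpr
      (by simpa using hψ1)
    refine IntegrableOn.congr_fun h1 (fun s hs => ?_) measurableSet_Ioi
    simp only
    rw [heq s hs]
  · have h1 := mellin_comp_rpow ψ (-z) (-1)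
    rw [Complex.ofReal_neg, Complex.ofReal_one, div_neg, div_one, neg_neg, hψ2, abs_neg, abs_one,
      inv_one, one_smul] at h1
    have h2 : mellin (fun s : ℝ => ψ (s ^ (-1 : ℝ))) (-z) =
        mellin (fun s : ℝ => ((s ^ (-m) * Real.exp (-(y / s)) : ℝ) : ℂ)) (-z) :=
      setIntegral_congr_fun measurableSet_Ioi fun s hs => by simp only; rw [heq s hs]
    rw [← h2, h1, neg_add, Complex.cpow_add _ _ hy0, Complex.ofReal_cpow hy.le, add_comm z]
    push_cast
    ring

/-- A scale mixture of the functions `e^{-y / s}` with a mixing density given by a Mellin-Barnes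
integral is again a Mellin-Barnes integral. -/
theorem laplace_convolution {m c T y : ℝ} {K : ℂ → ℂ} {f : ℝ → ℝ} (hy : 0 < y) (hT : 0 < T)
    (hm : 0 < m + c) (hK : Complex.VerticalIntegrable K c)
    (hf : ∀ s : ℝ, 0 < s → (f s : ℂ) = (s : ℂ)⁻¹ * mellinInv c K (s * T)) :
    IntegrableOn (fun s => s ^ (-m) * (Real.exp (-(y / s)) * f s)) (Ioi 0) ∧
      ((∫ s in Ioi (0 : ℝ), s ^ (-m) * (Real.exp (-(y / s)) * f s) : ℝ) : ℂ) =
        ((y ^ (-m) : ℝ) : ℂ) * mellinInv c (fun z => K z * Complex.Gamma (m + z)) (y * T) := by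
  set φ : ℝ → ℂ := fun s => ((s ^ (-m) * Real.exp (-(y / s)) : ℝ) : ℂ) with hφ
  have hφc : MellinConvergent φ (((-1 : ℝ) * c : ℝ) : ℂ) := by
    have := (mellin_rpow_mul_exp_neg_div (m := m) (z := c) hy (by simpa using hm)).1
    rwa [neg_one_mul, Complex.ofReal_neg]
  have hconv := mellinInv_convolution hT hK hφc
  have heq : ∀ s ∈ Ioi (0 : ℝ), mellinInv c K (T * s ^ (-(-1 : ℝ))) * φ s * (s : ℂ)⁻¹ =
      ((s ^ (-m) * (Real.exp (-(y / s)) * f s) : ℝ) : ℂ) := by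
    intro s hs
    rw [hφ, neg_neg, Real.rpow_one, mul_comm T, ← mul_assoc, Complex.ofReal_mul _ (f s), hf s hs]
    ring
  constructor
  · refine (IntegrableOn.congr_fun hconv.1 heq measurableSet_Ioi).re.congr (ae_of_all _ fun s => ?_)
    exact Complex.ofReal_re _
  · have h1 := hconv.2
    rw [setIntegral_congr_fun measurableSet_Ioi heq, integral_complex_ofReal] at h1
    refine h1.trans ?_
    rw [← mellinInv_cpow_mul _ hT hy, ← mellinInv_const_mul]
    refine congrFun (mellinInv_congr fun z hz => ?_) T
    have := (mellin_rpow_mul_exp_neg_div (m := m) (z := z) hy (by rw [hz]; exact hm)).2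
    rw [Complex.ofReal_neg, Complex.ofReal_one, neg_one_mul, hφ, this]
    ring

theorem besselDensity_eq {μ x s : ℝ} (hx : 0 < x) (hs : 0 < s) :
    besselDensity μ x s =
      x ^ (μ - 1) / Real.Gamma μ * (s ^ (-μ) * Real.exp (-(x / s))) := by
  rw [besselDensity, Real.div_rpow hx.le hs.le, Real.rpow_neg hs.le, Real.rpow_sub_one hs.ne']
  have := Real.rpow_pos_of_pos hs μ
  field_simp

theorem besselDensity_mul_mixedDensity {μ ν β : ℝ} (hν : 0 < ν) (hν1 : ν ≤ 1)
    (hβ : 0 < β) (hβ1 : β ≤ 1) (h11 : ¬(ν = 1 ∧ β = 1)) {c : ℝ} (hc : c ∈ Ioo (-min μ ν) ν)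
    {x t : ℝ} (hx : 0 < x) (ht : 0 < t) :
    IntegrableOn (fun s => besselDensity μ x s * mixedDensity ν β s t) (Ioi 0) ∧
      ((∫ s in Ioi (0 : ℝ), besselDensity μ x s * mixedDensity ν β s t : ℝ) : ℂ) =
        (x : ℂ)⁻¹ * mellinInv c (densityKernel μ ν β) (x * t ^ (-(β / ν))) := by
  have hcν : c ∈ Ioo (-ν) ν := ⟨by linarith [hc.1, min_le_right μ ν], hc.2⟩
  have hT : 0 < t ^ (-(β / ν)) := Real.rpow_pos_of_pos ht _
  have hL := laplace_convolution (m := μ) hx hT (by linarith [hc.1, min_le_left μ ν])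
    ((stripGrowth_mixedKernel hν hν1 hβ hβ1).verticalIntegrable
      (mixedKernel_rate_pos hν hν1 hβ1 h11) hcν)
    (fun s hs => mixedDensity_eq hν hν1 hβ hβ1 h11 hcν hs ht)
  have heq : ∀ s ∈ Ioi (0 : ℝ), x ^ (μ - 1) / Real.Gamma μ *
      (s ^ (-μ) * (Real.exp (-(x / s)) * mixedDensity ν β s t)) =
      besselDensity μ x s * mixedDensity ν β s t := by
    intro s hs
    rw [besselDensity_eq hx hs]
    ring
  constructor
  · exact IntegrableOn.congr_fun (hL.1.const_mul _) heq measurableSet_Ioi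
  · rw [← setIntegral_congr_fun measurableSet_Ioi heq, integral_const_mul, Complex.ofReal_mul,
      hL.2]
    have e : mellinInv c (densityKernel μ ν β) (x * t ^ (-(β / ν))) = (Real.Gamma μ : ℂ)⁻¹ *
        mellinInv c (fun z => mixedKernel ν β z * Complex.Gamma (μ + z)) (x * t ^ (-(β / ν))) :=
      mellinInv_const_mul _ _ _ _
    have e2 : x ^ (μ - 1) * x ^ (-μ) = x⁻¹ := by
      rw [← Real.rpow_add hx, ← Real.rpow_neg_one]; ring_nf
    rw [e, ← Complex.ofReal_inv, ← e2]
    push_cast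
    ring

theorem densityKernel_one_one {μ : ℝ} {z : ℂ} (h₁ : -1 < z.re) (h₂ : z.re < 1) :
    densityKernel μ 1 1 z = (Real.Gamma μ : ℂ)⁻¹ * Complex.Gamma (μ + z) := by
  rw [densityKernel, mixedKernel, stableKernel_one h₂, Complex.ofReal_one, div_one,
    inverseStableKernel_one h₁, one_mul, one_mul]

theorem besselDensity_eq_mellinInv {μ : ℝ} (hμ : 0 < μ) {c : ℝ}
    (hc : c ∈ Ioo (-min μ 1) 1) {x t : ℝ} (hx : 0 < x) (ht : 0 < t) :
    (besselDensity μ x t : ℂ) = (x : ℂ)⁻¹ * mellinInv c (densityKernel μ 1 1) (x * t⁻¹) := by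
  set E : ℝ → ℂ := fun v => ((Real.exp (-v) : ℝ) : ℂ) with hE
  set Q : ℝ → ℂ := fun v => (v : ℂ) ^ (μ : ℂ) • E v with hQ
  have hcμ : 0 < c + μ := by linarith [hc.1, min_le_left μ 1]
  have hc1 : -1 < c := by linarith [hc.1, min_le_right μ 1]
  have hre (z : ℂ) (hz : z.re = c) : 0 < (z + μ : ℂ).re := by simpa [hz] using hcμ
  have hE1 : MellinConvergent E (c + μ) :=
    (Complex.GammaIntegral_convergent (hre c (by simp))).congr (ae_of_all _ fun v => by
      simp only [hE, smul_eq_mul, mul_comm, Complex.ofReal_neg, Complex.ofReal_exp])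
  have hmell (z : ℂ) (hz : z.re = c) :
      mellin Q z = Real.Gamma μ * densityKernel μ 1 1 z := by
    have hG : (Real.Gamma μ : ℂ) ≠ 0 :=
      Complex.ofReal_ne_zero.mpr (Real.Gamma_pos_of_pos hμ).ne'
    rw [hQ, mellin_cpow_smul, ← Complex.GammaIntegral_eq_mellin, ← Complex.Gamma_eq_integral
      (hre z hz), densityKernel_one_one (by rw [hz]; exact hc1) (by rw [hz]; exact hc.2),
      mul_inv_cancel_left₀ hG, add_comm]
  have hxt : 0 < x * t⁻¹ := mul_pos hx (inv_pos.mpr ht)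
  have hvert : Complex.VerticalIntegrable (mellin Q) c := by
    have h := ((stripGrowth_densityKernel hμ one_pos le_rfl one_pos le_rfl).verticalIntegrable
      (densityKernel_rate_pos one_pos le_rfl le_rfl) hc).const_mul (Real.Gamma μ : ℂ)
    exact h.congr (ae_of_all _ fun v => (hmell _ (by simp)).symm)
  have hcont : ContinuousAt Q (x * t⁻¹) := by
    refine ContinuousAt.mul ?_ (by fun_prop)
    exact (hasDerivAt_ofReal_cpow hxt μ).continuousAt
  have hinv := mellinInv_mellin_eq c Q hxt (MellinConvergent.cpow_smul.mpr hE1) hvert hcont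
  rw [mellinInv_congr hmell, mellinInv_const_mul] at hinv
  have hG : (Real.Gamma μ : ℂ) ≠ 0 :=
    Complex.ofReal_ne_zero.mpr (Real.Gamma_pos_of_pos hμ).ne'
  have h2 : mellinInv c (densityKernel μ 1 1) (x * t⁻¹) =
      (((Real.Gamma μ)⁻¹ * ((x / t) ^ μ * Real.exp (-(x / t))) : ℝ) : ℂ) := by
    rw [eq_comm, Complex.ofReal_mul, Complex.ofReal_inv, inv_mul_eq_iff_eq_mul₀ hG, hinv, hQ, hE]
    simp only [smul_eq_mul, div_eq_mul_inv]
    rw [Complex.ofReal_mul, Complex.ofReal_cpow hxt.le]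
  rw [h2, besselDensity, Real.rpow_sub_one (div_pos hx ht).ne']
  have := Real.Gamma_pos_of_pos hμ
  have hx0 : (x : ℂ) ≠ 0 := Complex.ofReal_ne_zero.mpr hx.ne'
  rw [← Complex.ofReal_inv, ← Complex.ofReal_mul]
  congr 1
  field_simp

/-- The density `𝐠` as a Mellin-Barnes integral, on every line of the strip of its kernel. -/
theorem doublySubordinatedDensity_eq {μ ν β : ℝ} (hμ : 0 < μ) (hν : 0 < ν) (hν1 : ν ≤ 1)
    (hβ : 0 < β) (hβ1 : β ≤ 1) {c : ℝ} (hc : c ∈ Ioo (-min μ ν) ν)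
    {x t : ℝ} (hx : 0 < x) (ht : 0 < t) :
    (doublySubordinatedDensity μ ν β x t : ℂ) =
      (x : ℂ)⁻¹ * mellinInv c (densityKernel μ ν β) (x * t ^ (-(β / ν))) := by
  rw [doublySubordinatedDensity]
  split_ifs with h
  · obtain ⟨rfl, rfl⟩ := h
    rw [div_one, Real.rpow_neg_one]
    exact besselDensity_eq_mellinInv hμ hc hx ht
  · exact (besselDensity_mul_mixedDensity hν hν1 hβ hβ1 h hc hx ht).2

theorem doublySubordinatedDensity_one (μ ν : ℝ) :
    doublySubordinatedDensity μ ν 1 = subordinatedDensity μ ν := by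
  funext x t
  simp [doublySubordinatedDensity, subordinatedDensity, mixedDensity]

theorem mul_div_Gamma_mul {m : ℝ} {z : ℂ} (h : 0 < m + z.re) :
    (m + z) * Complex.Gamma (m + z) = Complex.Gamma (m + 1 + z) := by
  rw [add_right_comm, Complex.Gamma_add_one]
  intro h0
  have := congrArg Complex.re h0
  simp at this
  linarith

/-! ### The two equations -/

/-- The inner derivative of the operator `𝒜`. For `ν < 1`, the function `x^{1-μ} 𝐠(x, t)` is the
mixture of the exponentials `e^{-x/s}` with the density `s^{-μ} 𝔣(s, t) / Γ(μ)`. -/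
theorem hasRightFracDerivAt_doublySubordinatedDensity {μ ν β : ℝ} (hμ : 0 < μ) (hν : 0 < ν)
    (hν1 : ν ≤ 1) (hβ : 0 < β) (hβ1 : β ≤ 1) {c : ℝ} (hc : c ∈ Ioo (-min μ ν) ν)
    {x t : ℝ} (hx : 0 < x) (ht : 0 < t) :
    HasRightFracDerivAt ν (fun s => s ^ (1 - μ) * doublySubordinatedDensity μ ν β s t)
      (((x ^ (-(μ + ν)) : ℝ) : ℂ) * mellinInv c (fun z => (Real.Gamma μ : ℂ)⁻¹ *
        (mixedKernel ν β z * Complex.Gamma ((μ + ν : ℝ) + z))) (x * t ^ (-(β / ν)))).re x := by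
  have hcν : c ∈ Ioo (-ν) ν := ⟨by linarith [hc.1, min_le_right μ ν], hc.2⟩
  have hT : 0 < t ^ (-(β / ν)) := Real.rpow_pos_of_pos ht _
  have hcμ : 0 < μ + c := by linarith [hc.1, min_le_left μ ν]
  rcases eq_or_lt_of_le hν1 with rfl | hν'
  · rw [HasRightFracDerivAt, if_pos rfl]
    have hS := stripGrowth_densityKernel hμ hν hν1 hβ hβ1
    have hκ := densityKernel_rate_pos hν hν1 hβ1
    have h := hasDerivAt_rpow_mul_mellinInv (p := -μ) (r := 1) hT hx (hS.verticalIntegrable hκ hc)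
      (hS.id_mul.verticalIntegrable hκ hc)
    have h2 := Complex.reCLM.hasFDerivAt.comp_hasDerivAt x h
    have e : mellinInv c (fun z => (((-μ : ℝ) : ℂ) - (1 : ℝ) * z) * densityKernel μ 1 β z) =
        mellinInv c (fun z => -1 * ((Real.Gamma μ : ℂ)⁻¹ *
        (mixedKernel 1 β z * Complex.Gamma ((μ + 1 : ℝ) + z)))) := by
      refine mellinInv_congr fun z hz => ?_
      rw [densityKernel, Complex.ofReal_add, Complex.ofReal_one,
        ← mul_div_Gamma_mul (by rw [hz]; exact hcμ)]
      push_cast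
      ring
    rw [e, mellinInv_const_mul, Real.rpow_one] at h2
    refine HasDerivAt.congr_of_eventuallyEq (f := fun s => (((s ^ (-μ) : ℝ) : ℂ) *
      mellinInv c (densityKernel μ 1 β) (t ^ (-(β / 1)) * s ^ (1 : ℝ))).re) ?_ ?_
    · refine h2.congr_deriv ?_
      rw [mul_comm x, neg_add', Complex.reCLM_apply, ← Complex.neg_re]
      congr 1
      ring
    · filter_upwards [lt_mem_nhds hx] with s hs
      have h3 := doublySubordinatedDensity_eq hμ hν hν1 hβ hβ1 hc hs ht
      have h4 : s ^ (1 - μ) * s⁻¹ = s ^ (-μ) := by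
        rw [← Real.rpow_neg_one, ← Real.rpow_add hs]; ring_nf
      rw [Real.rpow_one, mul_comm _ s, ← h4, ← Complex.ofReal_re (_ * _)]
      congr 1
      rw [Complex.ofReal_mul, h3]
      push_cast
      ring
  · have h11 : ¬(ν = 1 ∧ β = 1) := fun h => hν'.ne h.1
    have hK := (stripGrowth_mixedKernel hν hν1 hβ hβ1).verticalIntegrable
      (mixedKernel_rate_pos hν hν1 hβ1 h11) hcν
    have hf := fun s hs => mixedDensity_eq hν hν1 hβ hβ1 h11 hcν (x := s) hs ht
    set r : ℝ → ℝ := fun σ => (Real.Gamma μ)⁻¹ * (σ ^ (-μ) * mixedDensity ν β σ t) with hr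
    have hre : ∀ y σ : ℝ, Real.exp (-(y / σ)) * r σ =
        (Real.Gamma μ)⁻¹ * (σ ^ (-μ) * (Real.exp (-(y / σ)) * mixedDensity ν β σ t)) :=
      fun y σ => by rw [hr]; ring
    have hint : ∀ y, 0 < y → IntegrableOn (fun σ => Real.exp (-(y / σ)) * r σ) (Ioi 0) := by
      intro y hy
      simp only [hre]
      exact (laplace_convolution hy hT hcμ hK hf).1.const_mul _
    have hmeas : AEStronglyMeasurable r (volume.restrict (Ioi 0)) := by
      have h1 : AEStronglyMeasurable (fun σ : ℝ => Real.exp (1 / σ))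
        (volume.restrict (Ioi 0)) := Measurable.aestronglyMeasurable (by fun_prop)
      refine (h1.mul (hint 1 one_pos).aestronglyMeasurable).congr (ae_of_all _ fun σ => ?_)
      simp only [Pi.mul_apply]
      rw [← mul_assoc, ← Real.exp_add]
      simp
    have h := hasRightFracDerivAt_of_laplace (r := r)
      (φ := fun s => s ^ (1 - μ) * doublySubordinatedDensity μ ν β s t) hν hν' hx hmeas hint (by
        intro s hs
        simp only [hre]
        rw [doublySubordinatedDensity, if_neg h11, ← integral_const_mul]
        refine setIntegral_congr_fun measurableSet_Ioi fun σ hσ => ?_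
        rw [besselDensity_eq hs hσ]
        have : s ^ (1 - μ) * s ^ (μ - 1) = 1 := by
          rw [← Real.rpow_add hs]; simp
        linear_combination ((Real.Gamma μ)⁻¹ * (σ ^ (-μ) * (Real.exp (-(s / σ)) *
          mixedDensity ν β σ t))) * this)
    have hw := laplace_convolution (m := μ + ν) hx hT (by linarith) hK hf
    convert h using 1
    rw [mellinInv_const_mul, ← Complex.ofReal_inv, mul_left_comm, ← hw.2, ← Complex.ofReal_mul,
      Complex.ofReal_re, ← integral_const_mul]
    refine setIntegral_congr_fun measurableSet_Ioi fun σ hσ => ?_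
    simp only [hre]
    have hσ' : (0 : ℝ) < σ := hσ
    rw [show -(μ + ν) = -ν + -μ by ring, Real.rpow_add hσ']
    ring

/-- The functional equation `Γ(z + 1) = z Γ(z)` turns the multiplier of the time derivative on the
line `Re z = c + ν` into that of the operator `𝒜` on the line `Re z = c`. -/
theorem densityKernel_multiplier {μ ν β : ℝ} (hν : 0 < ν) (hβ : 0 < β) (hβ1 : β ≤ 1) {z : ℂ}
    (hz : z.re < 0) (hz1 : -ν < z.re) :
    densityKernel μ ν β (z + ν) * (Complex.Gamma (1 + β / ν * (z + ν)) /
        Complex.Gamma (1 + β / ν * (z + ν) - β)) =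
      -((Real.Gamma μ : ℂ)⁻¹ * (mixedKernel ν β z * Complex.Gamma ((μ + ν : ℝ) + z)) *
        (Complex.Gamma (-z) / Complex.Gamma (-z - ν))) := by
  have hν0 : (ν : ℂ) ≠ 0 := Complex.ofReal_ne_zero.mpr hν.ne'
  have hz0 : z ≠ 0 := by rintro rfl; simp at hz
  have hzν : z + ν ≠ 0 := fun h => by
    have := congrArg Complex.re h
    simp at this
    linarith
  have h1 : Complex.Gamma (1 - z / ν) = -z / ν * Complex.Gamma (-z / ν) := by
    rw [← Complex.Gamma_add_one _ (div_ne_zero (neg_ne_zero.mpr hz0) hν0)]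
    congr 1; ring
  have h2 : Complex.Gamma (1 - (z + ν)) = (-z - ν) * Complex.Gamma (-z - ν) := by
    rw [← Complex.Gamma_add_one _ (by rw [← neg_add']; exact neg_ne_zero.mpr hzν)]
    congr 1; ring
  have h3 : Complex.Gamma (1 + (z + ν) / ν) = (1 + z / ν) * Complex.Gamma (1 + z / ν) := by
    rw [← Complex.Gamma_add_one]
    · congr 1; field_simp; ring
    · intro h
      refine hzν ?_
      field_simp at h
      simpa [add_comm] using h
  have h4 : Complex.Gamma (1 - z) = -z * Complex.Gamma (-z) := by
    rw [← Complex.Gamma_add_one _ (neg_ne_zero.mpr hz0)]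
    congr 1; ring
  have h5 : Complex.Gamma (-z) ≠ 0 := Complex.Gamma_ne_zero_of_re_pos (by simpa using hz)
  have h6 : Complex.Gamma (1 + β / ν * (z + ν)) ≠ 0 := by
    refine Complex.Gamma_ne_zero_of_re_pos ?_
    have h7 : (1 + β / ν * (z + ν) : ℂ).re = 1 + β / ν * (z.re + ν) := by
      rw [← Complex.ofReal_div]; simp
    have : 0 < β / ν * (z.re + ν) := mul_pos (by positivity) (by linarith)
    rw [h7]; linarith
  have e1 : (1 : ℂ) - (z + ν) / ν = -z / ν := by field_simp; ring
  have e2 : (1 : ℂ) + β * ((z + ν) / ν) = 1 + β / ν * (z + ν) := by ring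
  have e3 : (1 : ℂ) + β / ν * (z + ν) - β = 1 + β * (z / ν) := by field_simp; ring
  have e4 : (μ : ℂ) + (z + ν) = (μ + ν : ℝ) + z := by push_cast; ring
  have e5 : -z - (ν : ℂ) ≠ 0 := by rw [← neg_add']; exact neg_ne_zero.mpr hzν
  have h7 : Complex.Gamma (1 + β * (z / ν)) ≠ 0 := by
    refine Complex.Gamma_ne_zero_of_re_pos ?_
    have h8 : (1 + β / ν * (z + ν) - β : ℂ).re = 1 - β + β / ν * (z.re + ν) := by
      rw [← Complex.ofReal_div]; simp; ring
    have : 0 < β / ν * (z.re + ν) := mul_pos (by positivity) (by linarith)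
    rw [← e3, h8]; linarith
  simp only [densityKernel, mixedKernel, stableKernel, inverseStableKernel, e1, e2, e3, e4, h1, h2,
    h3, h4]
  generalize Complex.Gamma (-z - ν) = Y
  generalize Complex.Gamma (1 + β * (z / ν)) = X at h7
  generalize Complex.Gamma (1 + β / ν * (z + ν)) = W at h6
  generalize Complex.Gamma (1 + z / ν) = G
  generalize Complex.Gamma (-z / ν) = H
  generalize Complex.Gamma (-z) = J at h5
  -- `Y = Γ(-z - ν)` vanishes in Mathlib's convention where it has a pole.
  rcases eq_or_ne Y 0 with rfl | hY
  · simp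
  · field_simp
    ring

/-- Both sides of the second equation, computed on the line `Re z = c + ν` in time and on the line
`Re z = c` in space. -/
theorem exists_hasLeftFracDerivAt_hasCompositeOpAt {μ ν β : ℝ} (hμ : 0 < μ) (hν : 0 < ν)
    (hν1 : ν ≤ 1) (hβ : 0 < β) (hβ1 : β ≤ 1) {x t : ℝ} (hx : 0 < x) (ht : 0 < t) :
    ∃ a : ℝ, HasLeftFracDerivAt β (fun τ => doublySubordinatedDensity μ ν β x τ) a t ∧
      HasCompositeOpAt μ ν (fun y => doublySubordinatedDensity μ ν β y t) a x := by
  have hmin : 0 < min μ ν := lt_min hμ hν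
  -- `c < 0` makes `x ^ (-1 - z)` integrable at zero on the line `Re z = c`; in time, `c + ν > 0`
  -- makes `1 + b z` and `1 + b z - β` have positive real part on the line `Re z = c + ν`.
  obtain ⟨c, hc₁, hc₂⟩ := exists_between (neg_lt_zero.mpr hmin)
  have hcν : -ν < c := by linarith [min_le_right μ ν]
  have hcμ : -μ < c := by linarith [min_le_left μ ν]
  have hc : c ∈ Ioo (-min μ ν) ν := ⟨hc₁, by linarith⟩
  have hc' : c + ν ∈ Ioo (-min μ ν) ν := ⟨by linarith, by linarith⟩
  have hT : 0 < t ^ (-(β / ν)) := Real.rpow_pos_of_pos ht _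
  have hS := stripGrowth_densityKernel hμ hν hν1 hβ hβ1
  have hκ := densityKernel_rate_pos hν hν1 hβ1
  have hxS := (stripGrowth_const (x : ℂ)⁻¹ _ _).mul hS
  rw [zero_add] at hxS
  have htime := hasLeftFracDerivAt_of_mellinInv (α := β) (c := c + ν) (p := 0) (r := -(β / ν))
    (φ := fun τ => doublySubordinatedDensity μ ν β x τ)
    hβ1 hx ht (by
      have : 0 < β / ν * (c + ν) := mul_pos (by positivity) (by linarith)
      linarith) (hxS.verticalIntegrable hκ hc') (hxS.id_mul.verticalIntegrable hκ hc') (by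
      intro τ hτ
      rw [Real.rpow_zero, Complex.ofReal_one, one_mul, mellinInv_const_mul,
        ← doublySubordinatedDensity_eq hμ hν hν1 hβ hβ1 hc' hx hτ, Complex.ofReal_re])
  set w : ℝ → ℝ := fun y => (((y ^ (-(μ + ν)) : ℝ) : ℂ) * mellinInv c (fun z =>
    (Real.Gamma μ : ℂ)⁻¹ * (mixedKernel ν β z * Complex.Gamma ((μ + ν : ℝ) + z)))
    (y * t ^ (-(β / ν)))).re with hw
  have hS2 := (stripGrowth_const (Real.Gamma μ : ℂ)⁻¹ (-ν) ν).mul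
    (stripGrowth_mixedKernel_mul_Gamma (m := μ + ν) hν hν1 hβ hβ1 le_rfl hν (by linarith))
  rw [zero_add] at hS2
  have hc2 : c ∈ Ioo (-ν) ν := ⟨hcν, by linarith⟩
  have hspace := hasLeftFracDerivAt_of_mellinInv (α := ν) (c := c) (p := -1) (r := 1) (x := x)
    (φ := fun s => s ^ (μ - 1 + ν) * w s)
    hν1 hT hx (by linarith) (hS2.verticalIntegrable hκ hc2) (hS2.id_mul.verticalIntegrable hκ hc2)
    (by
      intro s hs
      have h1 : s ^ (μ - 1 + ν) * s ^ (-(μ + ν)) = s ^ (-1 : ℝ) := by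
        rw [← Real.rpow_add hs]; ring_nf
      rw [hw, ← h1, ← Complex.re_ofReal_mul, Real.rpow_one, mul_comm s (t ^ _)]
      congr 1
      push_cast
      ring)
  refine ⟨_, htime, w, fun y hy =>
    hasRightFracDerivAt_doublySubordinatedDensity hμ hν hν1 hβ hβ1 hc hy ht, ?_⟩
  convert hspace using 1
  rw [← Complex.neg_re]
  congr 1
  have hz : 0 < x * t ^ (-(β / ν)) := mul_pos hx hT
  rw [mellinInv_add hz, Real.rpow_one, mul_comm (t ^ _) x, ← mul_neg, ← mul_neg]
  have e : mellinInv c (fun z => (x : ℂ)⁻¹ * densityKernel μ ν β (z + ν) *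
      (Complex.Gamma (1 + (((0 : ℝ) : ℂ) - ((-(β / ν) : ℝ) : ℂ) * (z + ν))) /
        Complex.Gamma (1 + (((0 : ℝ) : ℂ) - ((-(β / ν) : ℝ) : ℂ) * (z + ν)) - β))) =
      mellinInv c (fun z => -(x : ℂ)⁻¹ * ((Real.Gamma μ : ℂ)⁻¹ *
        (mixedKernel ν β z * Complex.Gamma ((μ + ν : ℝ) + z)) *
        (Complex.Gamma (1 + (((-1 : ℝ) : ℂ) - (1 : ℝ) * z)) /
          Complex.Gamma (1 + (((-1 : ℝ) : ℂ) - (1 : ℝ) * z) - ν)))) := by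
    refine mellinInv_congr fun z hz => ?_
    have h := densityKernel_multiplier (μ := μ) hν hβ hβ1 (z := z) (by rw [hz]; exact hc₂)
      (by rw [hz]; exact hcν)
    have e1 : (1 : ℂ) + (((0 : ℝ) : ℂ) - ((-(β / ν) : ℝ) : ℂ) * (z + ν)) =
        1 + β / ν * (z + ν) := by push_cast; ring
    have e2 : (1 : ℂ) + (((-1 : ℝ) : ℂ) - (1 : ℝ) * z) = -z := by push_cast; ring
    rw [e1, e2, mul_assoc, h]
    ring
  rw [e, mellinInv_const_mul]
  have h3 : t ^ (0 - β) * (x * t ^ (-(β / ν))) ^ (-ν) * x⁻¹ = x ^ (-1 - ν) := by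
    rw [Real.mul_rpow hx.le hT.le, ← Real.rpow_mul ht.le,
      show -(β / ν) * -ν = β by field_simp, zero_sub, Real.rpow_neg ht.le, sub_eq_add_neg,
      Real.rpow_add hx, Real.rpow_neg_one]
    have := Real.rpow_pos_of_pos ht β
    field_simp
  rw [← h3]
  push_cast
  ring

/-! ### Integrability of the tails -/

theorem integrableOn_sub_rpow_mul_rpow_Ioi {ν q x : ℝ} (hν : 0 < ν) (hν1 : ν < 1)
    (hqν : 1 < q + ν) (hx : 0 < x) :
    IntegrableOn (fun s : ℝ => (s - x) ^ (-ν) * s ^ (-q)) (Ioi x) := by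
  have hmeas (A : Set ℝ) : AEStronglyMeasurable (fun s : ℝ => (s - x) ^ (-ν) * s ^ (-q))
    (volume.restrict A) := Measurable.aestronglyMeasurable (by fun_prop)
  rw [← Ioc_union_Ioi_eq_Ioi (show x ≤ x + 1 by linarith)]
  refine IntegrableOn.union ?_ ?_
  · have h1 : IntegrableOn (fun s : ℝ => (s - x) ^ (-ν)) (Ioc x (x + 1)) := by
      have h0 := (intervalIntegral.intervalIntegrable_rpow' (a := 0) (b := 1) (r := -ν)
        (by linarith)).comp_sub_right x enorm_ne_top
      rw [zero_add, add_comm, intervalIntegrable_iff_integrableOn_Ioc_of_le (by linarith)] at h0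
      exact h0
    refine (h1.mul_const (x ^ (-q))).mono' (hmeas _) ?_
    filter_upwards [ae_restrict_mem measurableSet_Ioc] with s hs
    have hs1 : 0 ≤ (s - x) ^ (-ν) := Real.rpow_nonneg (by linarith [hs.1]) _
    have hs2 : 0 ≤ s ^ (-q) := Real.rpow_nonneg (by linarith [hs.1]) _
    rw [norm_mul, Real.norm_of_nonneg hs1, Real.norm_of_nonneg hs2]
    exact mul_le_mul_of_nonneg_left (Real.rpow_le_rpow_of_nonpos hx hs.1.le (by linarith)) hs1
  · have h1 := integrableOn_add_rpow_Ioi_of_lt (a := -ν - q) (c := x + 1) (m := -x)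
      (by linarith) (by linarith)
    refine h1.mono' (hmeas _) ?_
    filter_upwards [ae_restrict_mem measurableSet_Ioi] with s hs
    have hs' : x + 1 < s := hs
    have hsx : 0 < s - x := by linarith
    have hs2 : 0 ≤ s ^ (-q) := Real.rpow_nonneg (by linarith) _
    rw [norm_mul, Real.norm_of_nonneg (Real.rpow_nonneg hsx.le _), Real.norm_of_nonneg hs2, ← sub_eq_add_neg, sub_eq_add_neg (-ν),
      Real.rpow_add hsx]
    exact mul_le_mul_of_nonneg_left (Real.rpow_le_rpow_of_nonpos hsx (by linarith) (by linarith))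
      (Real.rpow_nonneg hsx.le _)

/-- The kernel of `𝐠` extends to the right up to `Re z = ν`, so that `𝐠(x, t)` is `O(x^{-1-c})` for
every `c < ν`. -/
theorem integrableOn_tail_doublySubordinatedDensity {μ ν β : ℝ} (hμ : 0 < μ) (hν : 0 < ν)
    (hν1 : ν < 1) (hβ : 0 < β) (hβ1 : β ≤ 1) (h : 1 < μ + 2 * ν) {x t : ℝ} (hx : 0 < x)
    (ht : 0 < t) :
    IntegrableOn
      (fun s => (s - x) ^ (-ν) * (s ^ (1 - μ) * doublySubordinatedDensity μ ν β s t)) (Ioi x) := by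
  -- The integrand is `O((s - x)^{-ν} s^{-μ-c})`, which is integrable when `c > 1 - μ - ν`.
  obtain ⟨c, hc₁, hc₂⟩ := exists_between (show max (1 - μ - ν) 0 < ν from
    max_lt (by linarith) hν)
  have hc0 : 0 < c := (le_max_right _ _).trans_lt hc₁
  have hcμ : 1 - μ - ν < c := (le_max_left _ _).trans_lt hc₁
  have hmin : 0 < min μ ν := lt_min hμ hν
  have hc : c ∈ Ioo (-min μ ν) ν := ⟨by linarith, hc₂⟩
  have hT : 0 < t ^ (-(β / ν)) := Real.rpow_pos_of_pos ht _
  have hS := stripGrowth_densityKernel hμ hν hν1.le hβ hβ1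
  have hκ := densityKernel_rate_pos hν hν1.le hβ1
  have heq : ∀ s ∈ Ioi (0 : ℝ), ((s : ℂ)⁻¹ * mellinInv c (densityKernel μ ν β)
      (s * t ^ (-(β / ν)))).re = doublySubordinatedDensity μ ν β s t := by
    intro s hs
    rw [← doublySubordinatedDensity_eq hμ hν hν1.le hβ hβ1 hc hs ht, Complex.ofReal_re]
  have hcont : ContinuousOn (fun s => doublySubordinatedDensity μ ν β s t) (Ioi 0) := by
    refine ContinuousOn.congr (f := fun s : ℝ => ((s : ℂ)⁻¹ * mellinInv c (densityKernel μ ν β)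
      (s * t ^ (-(β / ν)))).re) ?_ fun s hs => (heq s hs).symm
    refine Complex.continuous_re.comp_continuousOn (ContinuousOn.mul ?_ ?_)
    · exact ContinuousOn.inv₀ (by fun_prop) fun s hs =>
        Complex.ofReal_ne_zero.mpr (ne_of_gt hs)
    · exact (hS.continuousOn_mellinInv hκ hc).comp (by fun_prop) fun s hs => mul_pos hs hT
  set C := 1 / (2 * Real.pi) * ∫ y : ℝ, ‖densityKernel μ ν β (c + y * Complex.I)‖ with hC
  refine ((integrableOn_sub_rpow_mul_rpow_Ioi (q := μ + c) hν hν1 (by linarith)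
    hx).mul_const (C * (t ^ (-(β / ν))) ^ (-c))).mono' ?_ ?_
  · refine AEStronglyMeasurable.mul (Measurable.aestronglyMeasurable (by fun_prop))
      (AEStronglyMeasurable.mul (Measurable.aestronglyMeasurable (by fun_prop)) ?_)
    exact (hcont.mono (Ioi_subset_Ioi hx.le)).aestronglyMeasurable measurableSet_Ioi
  · filter_upwards [ae_restrict_mem measurableSet_Ioi] with s hs
    have hs' : x < s := hs
    have hs0 : 0 < s := hx.trans hs'
    have hsT : 0 < s * t ^ (-(β / ν)) := mul_pos hs0 hT
    have hb : ‖doublySubordinatedDensity μ ν β s t‖ ≤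
        s⁻¹ * (C * (s ^ (-c) * (t ^ (-(β / ν))) ^ (-c))) := by
      rw [← Complex.norm_real, doublySubordinatedDensity_eq hμ hν hν1.le hβ hβ1 hc hs0 ht,
        norm_mul, norm_inv, Complex.norm_real, Real.norm_of_nonneg hs0.le,
        ← Real.mul_rpow hs0.le hT.le]
      gcongr
      exact norm_mellinInv_le _ hsT
    have e : s ^ (-(μ + c)) = s ^ (1 - μ) * (s⁻¹ * s ^ (-c)) := by
      rw [← Real.rpow_neg_one, ← Real.rpow_add hs0, ← Real.rpow_add hs0]; ring_nf
    rw [norm_mul, norm_mul, Real.norm_of_nonneg (Real.rpow_nonneg (by linarith) _),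
      Real.norm_of_nonneg (Real.rpow_nonneg hs0.le _)]
    have h1 : 0 ≤ (s - x) ^ (-ν) := Real.rpow_nonneg (by linarith) _
    calc _ ≤ (s - x) ^ (-ν) * (s ^ (1 - μ) *
          (s⁻¹ * (C * (s ^ (-c) * (t ^ (-(β / ν))) ^ (-c))))) := by gcongr
      _ = _ := by rw [e]; ring

/-! ### The profile -/

theorem foxContour_profile_iff {c μ ν β : ℝ} (hν : 0 < ν) :
    FoxContour c 2 1 (upperParams μ ν β) (lowerParams μ ν) ↔ -min μ ν < c ∧ c < 0 := by
  have h1 : 0 < 1 + c * ν⁻¹ ↔ -ν < c := by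
    rw [← div_eq_mul_inv, ← neg_lt_iff_pos_add', lt_div_iff₀ hν, neg_one_mul]
  have h2 : c * ν⁻¹ < 0 ↔ c < 0 := by
    rw [← div_eq_mul_inv, div_lt_iff₀ hν, zero_mul]
  have h3 : -min μ ν < c ↔ 0 < μ + c ∧ -ν < c := by
    rw [neg_lt, lt_min_iff, neg_lt_iff_pos_add', add_comm c, neg_lt (a := c)]
  simp [FoxContour, upperParams, lowerParams, Fin.forall_fin_succ, h1, h2, h3]

/-- The factors `Γ(-z/ν) / Γ(-z)` of the Fox kernel have removable singularities at `0`; removing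
them leaves the kernel `densityKernel`, whose strip extends beyond `Re z = 0`. -/
theorem foxKernel_profile {μ ν β : ℝ} (hν : 0 < ν) {z : ℂ} (hz : z ≠ 0) :
    foxKernel 2 1 (upperParams μ ν β) (lowerParams μ ν) z = ν * densityKernel μ ν β z := by
  have hν0 : (ν : ℂ) ≠ 0 := Complex.ofReal_ne_zero.mpr hν.ne'
  have h1 : Complex.Gamma (1 - z / ν) = -z / ν * Complex.Gamma (-z / ν) := by
    rw [← Complex.Gamma_add_one _ (div_ne_zero (neg_ne_zero.mpr hz) hν0)]
    congr 1; ring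
  have h4 : Complex.Gamma (1 - z) = -z * Complex.Gamma (-z) := by
    rw [← Complex.Gamma_add_one _ (neg_ne_zero.mpr hz)]
    congr 1; ring
  simp only [foxKernel, upperParams, lowerParams, Finset.prod_filter, Fin.prod_univ_succ]
  simp [densityKernel, mixedKernel, stableKernel, inverseStableKernel, h1, h4]
  rw [show z * (ν : ℂ)⁻¹ = z / ν from (div_eq_mul_inv _ _).symm, ← neg_div,
    show z * ((β : ℂ) / ν) = β * (z / ν) by ring, Complex.Gamma_ofReal]
  field_simp


theorem theorem4 (μ ν β : ℝ) (hμ : 0 < μ) (hν : 0 < ν) (hν1 : ν ≤ 1) (hβ : 0 < β) (hβ1 : β ≤ 1) :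
    -- the integrals that define the densities converge
    (∀ x t : ℝ, 0 < x → 0 < t →
      (ν < 1 → IntegrableOn (fun s => besselDensity μ x s * stableDensity ν s t) (Ioi 0)) ∧
      (ν < 1 → β < 1 →
        IntegrableOn (fun s => stableDensity ν x s * inverseStableDensity β s t) (Ioi 0)) ∧
      (¬(ν = 1 ∧ β = 1) →
        IntegrableOn (fun s => besselDensity μ x s * mixedDensity ν β s t) (Ioi 0))) ∧
    -- if `ν < 1` and `μ + 2 ν > 1`, then so do the integrals in the right-sided derivatives
    (ν < 1 → 1 < μ + 2 * ν → ∀ x t : ℝ, 0 < x → 0 < t →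
      IntegrableOn
        (fun s => (s - x) ^ (-ν) * (s ^ (1 - μ) * subordinatedDensity μ ν s t)) (Ioi x) ∧
      IntegrableOn
        (fun s => (s - x) ^ (-ν) * (s ^ (1 - μ) * doublySubordinatedDensity μ ν β s t))
        (Ioi x)) ∧
    -- i) the first equation
    (∀ x t : ℝ, 0 < x → 0 < t → ∃ a : ℝ,
      HasDerivAt (fun τ => subordinatedDensity μ ν x τ) a t ∧
      HasCompositeOpAt μ ν (fun y => subordinatedDensity μ ν y t) a x) ∧
    -- ii) the second equation
    (∀ x t : ℝ, 0 < x → 0 < t → ∃ a : ℝ,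
      HasLeftFracDerivAt β (fun τ => doublySubordinatedDensity μ ν β x τ) a t ∧
      HasCompositeOpAt μ ν (fun y => doublySubordinatedDensity μ ν β y t) a x) ∧
    -- the explicit form, for each admissible line of integration; such lines exist
    (∃ c : ℝ, FoxContour c 2 1 (upperParams μ ν β) (lowerParams μ ν)) ∧
    (∀ c : ℝ, FoxContour c 2 1 (upperParams μ ν β) (lowerParams μ ν) →
      Complex.VerticalIntegrable (foxKernel 2 1 (upperParams μ ν β) (lowerParams μ ν)) c ∧
      ∀ x t : ℝ, 0 < x → 0 < t →
        (doublySubordinatedDensity μ ν β x t : ℂ) =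
          ((1 / t ^ (β / ν) : ℝ) : ℂ) * profileG c μ ν β (x / t ^ (β / ν))) := by
  have hmin : 0 < min μ ν := lt_min hμ hν
  have h0 : (0 : ℝ) ∈ Ioo (-min μ ν) ν := ⟨by linarith, hν⟩
  refine ⟨?_, ?_, ?_, ?_, ?_, ?_⟩
  · intro x t hx ht
    refine ⟨fun h => ?_, fun h h' => ?_, fun h => ?_⟩
    · have h1 := (besselDensity_mul_mixedDensity (μ := μ) hν hν1 one_pos le_rfl
        (fun h' => h.ne h'.1) h0 hx ht).1
      simpa [mixedDensity] using h1
    · exact (mixedDensity_convolution hν h hβ h' (c := 0) ⟨by linarith, hν⟩ hx ht).1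
    · exact (besselDensity_mul_mixedDensity hν hν1 hβ hβ1 h h0 hx ht).1
  · intro hν' h x t hx ht
    have h1 := integrableOn_tail_doublySubordinatedDensity hμ hν hν' one_pos le_rfl h hx ht
    rw [doublySubordinatedDensity_one] at h1
    exact ⟨h1, integrableOn_tail_doublySubordinatedDensity hμ hν hν' hβ hβ1 h hx ht⟩
  · intro x t hx ht
    obtain ⟨a, h1, h2⟩ := exists_hasLeftFracDerivAt_hasCompositeOpAt hμ hν hν1 one_pos le_rfl hx ht
    rw [doublySubordinatedDensity_one] at h1 h2
    rw [HasLeftFracDerivAt, if_pos rfl] at h1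
    exact ⟨a, h1, h2⟩
  · intro x t hx ht
    exact exists_hasLeftFracDerivAt_hasCompositeOpAt hμ hν hν1 hβ hβ1 hx ht
  · obtain ⟨c, hc⟩ := exists_between (neg_lt_zero.mpr hmin)
    exact ⟨c, (foxContour_profile_iff hν).mpr hc⟩
  · intro c hc
    rw [foxContour_profile_iff hν] at hc
    have hc' : c ∈ Ioo (-min μ ν) ν := ⟨hc.1, by linarith [hc.2]⟩
    have hz0 : ∀ z : ℂ, z.re = c → z ≠ 0 := by
      rintro z hz rfl
      rw [Complex.zero_re] at hz
      linarith [hc.2]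
    constructor
    · have h1 := ((stripGrowth_densityKernel hμ hν hν1 hβ hβ1).verticalIntegrable
        (densityKernel_rate_pos hν hν1 hβ1) hc').const_mul (ν : ℂ)
      exact h1.congr (ae_of_all _ fun v => (foxKernel_profile hν (hz0 _ (by simp))).symm)
    · intro x t hx ht
      have hν0 : (ν : ℂ) ≠ 0 := Complex.ofReal_ne_zero.mpr hν.ne'
      have hx0 : (x : ℂ) ≠ 0 := Complex.ofReal_ne_zero.mpr hx.ne'
      have htp := Real.rpow_pos_of_pos ht (β / ν)
      have ht0 : ((t ^ (β / ν) : ℝ) : ℂ) ≠ 0 := Complex.ofReal_ne_zero.mpr htp.ne'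
      rw [doublySubordinatedDensity_eq hμ hν hν1 hβ hβ1 hc' hx ht, profileG, foxH,
        mellinInv_congr fun z hz => foxKernel_profile hν (hz0 z hz), mellinInv_const_mul,
        Real.rpow_neg ht.le, ← div_eq_mul_inv x]
      rw [Complex.ofReal_div x, Complex.ofReal_div 1, Complex.ofReal_one]
      field_simp
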